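/- Let $\mathbb{C}_+=\{z\in\mathbb{C}:\operatorname{Re} z>0\}$. Let $H^\infty(\mathbb{C}_+)$ be the space of bounded holomorphic functions on $\mathbb{C}_+$, and for $f\in H^\infty(\mathbb{C}_+)$ let $f^b\in L^\infty(\mathbb{R})$, $f^b(s)=\lim_{t\to0+}f(t+is)$ for almost every $s$, be its boundary function. For a closed set $I\subset[0,\infty)$ put $$H^\infty(I)=\{f\in H^\infty(\mathbb{C}_+):\operatorname{supp}(\mathcal{F}^{-1}f^b)\subset I\},$$ where $\mathcal{F}^{-1}$ is the inverse Fourier transform of tempered distributions on $\mathbb{R}$, given on Schwartz functions by $(\mathcal{F}^{-1}\varphi)(t)=\frac1{2\pi}\int_{\mathbb{R}}\varphi(s)e^{ist}\,ds$, and $\operatorname{supp}$ is the support of a distribution. Let $\mathcal{B}$ be the space of holomorphic functions $f$ on $\mathbb{C}_+$ such that $$\int_0^\infty\sup_{y\in\mathbb{R}}|f'(x+iy)|\,dx<\infty,$$ with the norm $$\|f\|_{\mathcal{B}}=\sup_{z\in\mathbb{C}_+}|f(z)|+\int_0^\infty\sup_{y\in\mathbb{R}}|f'(x+iy)|\,dx,$$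 and let $\mathcal{B}_0=\{f\in\mathcal{B}: f(\infty)=0\}$, where $f(\infty)=\lim_{\operatorname{Re} z\to\infty}f(z)$ (this limit exists for every $f\in\mathcal{B}$). Then the set $$\mathcal{G}:=\bigcup_{0<\varepsilon<\delta}H^\infty[\varepsilon,\delta]$$ is contained in $\mathcal{B}_0$ and is dense in $\mathcal{B}_0$ with respect to the norm $\|\cdot\|_{\mathcal{B}}$. -/

import Mathlib

namespace BesovHalfPlane

open Filter Topology MeasureTheory Complex
open scoped SchwartzMap FourierTransform ENNReal

noncomputable section

/-! Functions on the right half-plane `ℂ₊ = {z | 0 < re z}` are represented by functions `ℂ → ℂ`;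
all notions below depend only on the restriction to `ℂ₊`. -/

/-- The open right half-plane `ℂ₊`. -/
def rightHalfPlane : Set ℂ := {z | 0 < z.re}

/-- `H^∞(ℂ₊)`: the bounded holomorphic functions on `ℂ₊`. -/
def HInfty : Set (ℂ → ℂ) :=
  {f | DifferentiableOn ℂ f rightHalfPlane ∧ ∃ C : ℝ, ∀ z ∈ rightHalfPlane, ‖f z‖ ≤ C}

/-- `g ∈ L^∞(ℝ)` is the boundary function of `f`:
`f (t + i s) → g s` as `t → 0+`, for almost every `s`. -/
def IsBoundaryFunction (f : ℂ → ℂ) (g : Lp ℂ ∞ (volume : Measure ℝ)) : Prop :=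
  ∀ᵐ s : ℝ, Tendsto (fun t : ℝ => f (t + s * I)) (𝓝[>] 0) (𝓝 (g s))

/-- The inverse Fourier transform `φ ↦ (t ↦ (2π)⁻¹ ∫ φ(s) e^{ist} ds)` on Schwartz functions,
see `invFourierSchwartz_apply`. -/
def invFourierSchwartz : 𝓢(ℝ, ℂ) →L[ℂ] 𝓢(ℝ, ℂ) :=
  ((2 * Real.pi : ℂ)⁻¹) •
    (SchwartzMap.compCLMOfContinuousLinearEquiv ℂ
      (ContinuousLinearEquiv.smulLeft (R₁ := ℝ) (M₁ := ℝ)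
        (Units.mk0 ((2 * Real.pi)⁻¹ : ℝ) (by positivity)))).comp
    (FourierTransform.fourierInvCLM ℂ 𝓢(ℝ, ℂ))

theorem invFourierSchwartz_apply (φ : 𝓢(ℝ, ℂ)) (t : ℝ) :
    invFourierSchwartz φ t = (2 * Real.pi : ℂ)⁻¹ * ∫ s : ℝ, φ s * exp (I * s * t) := by
  have h : invFourierSchwartz φ t
      = (2 * Real.pi : ℂ)⁻¹ * (𝓕⁻ (φ : ℝ → ℂ)) ((2 * Real.pi)⁻¹ * t) := by
    rw [← SchwartzMap.fourierInv_coe]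
    rfl
  rw [h, Real.fourierInv_eq']
  congr 1
  refine integral_congr_ae (Eventually.of_forall fun s => ?_)
  simp only [smul_eq_mul, RCLike.inner_apply, conj_trivial]
  rw [mul_comm]
  congr 2
  push_cast
  field_simp

/-- The inverse Fourier transform of a tempered distribution, by duality, see `invFourier_apply`. -/
def invFourier (u : 𝓢'(ℝ, ℂ)) : 𝓢'(ℝ, ℂ) :=
  PointwiseConvergenceCLM.precomp ℂ invFourierSchwartz u

theorem invFourier_apply (u : 𝓢'(ℝ, ℂ)) (φ : 𝓢(ℝ, ℂ)) :
    invFourier u φ = u (invFourierSchwartz φ) := rfl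

/-- The spectral subspace `H^∞(K)`: the functions `f ∈ H^∞(ℂ₊)` such that the support of the
(distributional) inverse Fourier transform of the boundary function of `f` is contained in `K`. -/
def spectralSubspace (K : Set ℝ) : Set (ℂ → ℂ) :=
  {f | f ∈ HInfty ∧ ∃ g : Lp ℂ ∞ (volume : Measure ℝ), IsBoundaryFunction f g ∧
    Distribution.dsupport (invFourier (Lp.toTemperedDistribution g)) ⊆ K}

/-- `𝒢`, the union of the spectral subspaces `H^∞[ε, δ]` over `0 < ε < δ`. -/
def spectralUnion : Set (ℂ → ℂ) :=
  {f | ∃ ε δ : ℝ, 0 < ε ∧ ε < δ ∧ f ∈ spectralSubspace (Set.Icc ε δ)}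

/-- The Besov seminorm `∫₀^∞ sup_y |f'(x + i y)| dx`, with values in `[0, ∞]`. -/
def besovSeminorm (f : ℂ → ℂ) : ℝ≥0∞ :=
  ∫⁻ x in Set.Ioi (0 : ℝ), ⨆ y : ℝ, ‖deriv f (x + y * I)‖ₑ

/-- The supremum norm on `ℂ₊`, with values in `[0, ∞]`. -/
def supNorm (f : ℂ → ℂ) : ℝ≥0∞ := ⨆ z ∈ rightHalfPlane, ‖f z‖ₑ

/-- The norm of `𝓑`. -/
def besovNorm (f : ℂ → ℂ) : ℝ≥0∞ := supNorm f + besovSeminorm f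

/-- The Besov algebra `𝓑`. -/
def besov : Set (ℂ → ℂ) :=
  {f | DifferentiableOn ℂ f rightHalfPlane ∧ besovSeminorm f < ∞}

/-- `𝓑₀ = {f ∈ 𝓑 | f(∞) = 0}`, where `f(∞)` is the limit of `f z` as `re z → ∞`. -/
def besovZero : Set (ℂ → ℂ) :=
  {f | f ∈ besov ∧ Tendsto f (comap Complex.re atTop) (𝓝 0)}

end

end BesovHalfPlane

namespace BesovHalfPlane

open Filter Topology MeasureTheory Complex
open scoped SchwartzMap FourierTransform ENNReal

noncomputable section

/-! Everything is done with smooth spectral multipliers. For a test function `φ`, convolving a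
function on a vertical line with `kern φ` multiplies its inverse Fourier transform by `φ`. Since
`kern φ` is entire and decays quadratically on vertical strips, Cauchy's theorem lets these
convolutions be computed on any vertical line in `ℂ₊`.

Inclusion: if `f` has spectrum in `[ε, δ]` and `η = 1` near `[ε, δ]`, then `f` equals its
convolution with `kern η` (`exists_entire_extension`). This extends `f` to an entire function of
size `O(exp(-ε x / 2))` for `x = re z ≥ -1`. Cauchy's estimate gives the same decay for `f'`, so `f
∈ 𝓑₀`.

Density: take a bump `χ` equal to `1` near `0` and approximate `f` by its multiplier with symbol
`χ(b t) - χ(m t)`, for `b` small and `m` large. Two errors remain. Low frequencies, symbol `χ(m t)`: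
evaluated on the line shifted by `m`, this part is an average of `f(w + m + i m s)` against a kernel
independent of `m`, so its norm is bounded by a constant times the tail `∫_m^∞ sup_y |f'(x + iy)|
dx` (`tendsto_besovNorm_kernSmooth_low`). High frequencies, symbol `1 - χ(b t)`: this is `f` minus a
vertical average at scale `b`. It tends to `0` by uniform continuity of `f` along vertical lines
and, for the seminorm, by dominated convergence (`tendsto_besovNorm_sub_kernSmooth`). The symbol
also lives on negative frequencies, but these contribute nothing for bounded holomorphic `f`
(`kernSmooth_mem_spectralSubspace`). -/

/-! ### Shifting vertical contours -/

theorem integrable_const_div_one_add_sq (C : ℝ) : Integrable fun y : ℝ => C / (1 + y ^ 2) := by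
  simpa [div_eq_mul_inv] using integrable_inv_one_add_sq.const_mul C

theorem vertical_continuous {H : ℂ → ℂ} {s : Set ℂ} (hd : ContinuousOn H s) {x : ℝ}
    (hx : ∀ y : ℝ, (x + y * I : ℂ) ∈ s) : Continuous fun y : ℝ => H (x + y * I) :=
  hd.comp_continuous (by fun_prop) hx

/-- The integral over a vertical line does not depend on the line. -/
theorem integral_vertical_eq {H : ℂ → ℂ} {x₁ x₂ C : ℝ} (h12 : x₁ ≤ x₂)
    (hd : DifferentiableOn ℂ H (re ⁻¹' Set.Icc x₁ x₂))
    (hb : ∀ x ∈ Set.Icc x₁ x₂, ∀ y : ℝ, ‖H (x + y * I)‖ ≤ C / (1 + y ^ 2)) :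
    ∫ y : ℝ, H (x₁ + y * I) = ∫ y : ℝ, H (x₂ + y * I) := by
  have key : ∀ T : ℝ, 0 ≤ T →
      ((∫ x : ℝ in x₁..x₂, H (x + (-T : ℝ) * I)) - ∫ x : ℝ in x₁..x₂, H (x + (T : ℝ) * I)) +
      I • (∫ y : ℝ in (-T)..T, H (x₂ + y * I)) - I • (∫ y : ℝ in (-T)..T, H (x₁ + y * I)) = 0 := by
    intro T hT
    have := integral_boundary_rect_eq_zero_of_differentiableOn H (x₁ + (-T : ℝ) * I)
      (x₂ + (T : ℝ) * I) (hd.mono ?_)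
    · simpa using this
    · intro z hz
      simp only [mem_reProdIm] at hz
      have := hz.1
      simpa [Set.uIcc_of_le h12] using this
  have hint : ∀ x ∈ Set.Icc x₁ x₂, Integrable fun y : ℝ => H (x + y * I) := by
    intro x hx
    refine (integrable_const_div_one_add_sq C).mono' ?_ (Eventually.of_forall (hb x hx))
    exact (vertical_continuous hd.continuousOn (fun y => by simpa using hx)).aestronglyMeasurable
  have hvert : ∀ x ∈ Set.Icc x₁ x₂, Tendsto (fun T : ℝ => ∫ y : ℝ in (-T)..T, H (x + y * I)) atTop
      (𝓝 (∫ y : ℝ, H (x + y * I))) := fun x hx =>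
    intervalIntegral_tendsto_integral (hint x hx) tendsto_neg_atTop_atBot tendsto_id
  have hdec : Tendsto (fun T : ℝ => C / (1 + T ^ 2) * |x₂ - x₁|) atTop (𝓝 0) := by
    rw [← zero_mul |x₂ - x₁|]
    refine Tendsto.mul_const _ ?_
    refine Tendsto.div_atTop tendsto_const_nhds ?_
    exact tendsto_atTop_add_const_left _ _ (tendsto_pow_atTop two_ne_zero)
  -- The sign `σ = ±1` treats the top and bottom edges of the rectangle at once.
  have hhor : ∀ σ : ℝ, σ ^ 2 = 1 →
      Tendsto (fun T : ℝ => ∫ x : ℝ in x₁..x₂, H (x + (σ * T : ℝ) * I)) atTop (𝓝 0) := by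
    intro σ hσ
    refine squeeze_zero_norm (fun T => ?_) hdec
    refine intervalIntegral.norm_integral_le_of_norm_le_const fun x hx => ?_
    rw [Set.uIoc_of_le h12] at hx
    have := hb x (Set.Ioc_subset_Icc_self hx) (σ * T)
    rwa [mul_pow, hσ, one_mul] at this
  have lim := (((hhor (-1) (by norm_num)).sub (hhor 1 (by norm_num))).add
    ((hvert x₂ ⟨h12, le_rfl⟩).const_smul I)).sub ((hvert x₁ ⟨le_rfl, h12⟩).const_smul I)
  have h0 := tendsto_nhds_unique_of_eventuallyEq lim tendsto_const_nhds
    ((eventually_ge_atTop 0).mono fun T hT => by simpa using key T hT)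
  simp only [sub_self, zero_add, smul_eq_mul, ← mul_sub] at h0
  have := (mul_eq_zero.mp h0).resolve_left I_ne_zero
  exact (sub_eq_zero.mp this).symm

/-! ### Laplace kernels of test functions -/

/-- The Laplace type kernel `z ↦ (2π)⁻¹ ∫ φ(t) e^{-zt} dt`. -/
def kern (φ : ℝ → ℂ) (z : ℂ) : ℂ := (2 * Real.pi : ℂ)⁻¹ * ∫ t : ℝ, φ t * exp (-(z * t))

theorem norm_exp_neg_mul_ofReal (z : ℂ) (t : ℝ) : ‖exp (-(z * t))‖ = Real.exp (-(z.re * t)) := by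
  rw [Complex.norm_exp]; simp

theorem integrable_kern {φ : ℝ → ℂ} (hφ : Continuous φ) (hc : HasCompactSupport φ) (z : ℂ) :
    Integrable fun t : ℝ => φ t * exp (-(z * t)) :=
  (hφ.mul (by fun_prop)).integrable_of_hasCompactSupport hc.mul_right

theorem kern_sub {φ ψ : ℝ → ℂ} (hφ : Continuous φ) (hc : HasCompactSupport φ)
    (hψ : Continuous ψ) (hcψ : HasCompactSupport ψ) (z : ℂ) :
    kern (fun t => φ t - ψ t) z = kern φ z - kern ψ z := by
  simp only [kern, sub_mul]
  rw [integral_sub (integrable_kern hφ hc z) (integrable_kern hψ hcψ z), mul_sub]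

theorem invFourierSchwartz_eq_kern (φ : 𝓢(ℝ, ℂ)) (s : ℝ) :
    invFourierSchwartz φ s = kern φ (-(s * I)) := by
  rw [invFourierSchwartz_apply, kern]
  congr 1
  refine integral_congr_ae (Eventually.of_forall fun t => ?_)
  simp only
  congr 2
  ring

theorem kern_deriv {φ : ℝ → ℂ} (hφ : ContDiff ℝ (⊤ : ℕ∞) φ) (hc : HasCompactSupport φ) (z : ℂ) :
    kern (deriv φ) z = z * kern φ z := by
  have hd : ContDiff ℝ (⊤ : ℕ∞) (deriv φ) := ((contDiff_infty_iff_deriv (𝕜 := ℝ)).1 hφ).2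
  have h := integral_mul_deriv_eq_deriv_mul_of_integrable (u := φ) (u' := deriv φ)
    (v := fun t : ℝ => exp (-(z * t))) (v' := fun t : ℝ => exp (-(z * t)) * (-z))
    (fun x _ => (hφ.differentiable (by simp) x).hasDerivAt)
    (fun x _ => by
      have : HasDerivAt (fun t : ℝ => -(z * t)) (-z) x := by
        simpa using ((hasDerivAt_id x).ofReal_comp.const_mul z).fun_neg
      exact this.cexp)
    (by
      have := (integrable_kern hφ.continuous hc z).mul_const (-z)
      refine this.congr (Eventually.of_forall fun t => ?_)
      simp [mul_assoc])
    (integrable_kern hd.continuous hc.deriv z) (integrable_kern hφ.continuous hc z)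
  rw [kern, kern]
  have h2 : ∫ t : ℝ, deriv φ t * exp (-(z * t)) = z * ∫ t : ℝ, φ t * exp (-(z * t)) := by
    rw [← neg_eq_iff_eq_neg.mpr h, ← integral_neg, ← integral_const_mul]
    congr 1; ext t; ring
  rw [h2]; ring

theorem exp_neg_mul_le {α β t x : ℝ} (ht : t ∈ Set.Icc α β) :
    Real.exp (-(x * t)) ≤ Real.exp (-(α * x)) + Real.exp (-(β * x)) := by
  rcases le_total 0 x with hx | hx
  · have : Real.exp (-(x * t)) ≤ Real.exp (-(α * x)) := Real.exp_le_exp.2 (by nlinarith [ht.1])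
    linarith [Real.exp_pos (-(β * x))]
  · have : Real.exp (-(x * t)) ≤ Real.exp (-(β * x)) := Real.exp_le_exp.2 (by nlinarith [ht.2])
    linarith [Real.exp_pos (-(α * x))]

theorem norm_kern_le {φ : ℝ → ℂ} (hφ : Continuous φ) {α β : ℝ}
    (hs : tsupport φ ⊆ Set.Icc α β) (z : ℂ) :
    ‖kern φ z‖ ≤ (∫ t, ‖φ t‖) * (Real.exp (-(α * z.re)) + Real.exp (-(β * z.re))) := by
  have hc : HasCompactSupport φ := isCompact_Icc.of_isClosed_subset (isClosed_tsupport φ) hs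
  have h1 : ‖∫ t : ℝ, φ t * exp (-(z * t))‖ ≤
      ∫ t, ‖φ t‖ * (Real.exp (-(α * z.re)) + Real.exp (-(β * z.re))) := by
    refine norm_integral_le_of_norm_le
      ((hφ.integrable_of_hasCompactSupport hc).norm.mul_const _) (Eventually.of_forall fun t => ?_)
    rw [norm_mul, norm_exp_neg_mul_ofReal]
    by_cases ht : t ∈ tsupport φ
    · exact mul_le_mul_of_nonneg_left (exp_neg_mul_le (hs ht)) (norm_nonneg _)
    · simp [image_eq_zero_of_notMem_tsupport ht]
  rw [integral_mul_const] at h1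
  rw [kern, norm_mul]
  have h2 : ‖(2 * Real.pi : ℂ)⁻¹‖ ≤ 1 := by
    rw [norm_inv, norm_mul, Complex.norm_real, Real.norm_of_nonneg Real.pi_pos.le, Complex.norm_two]
    exact inv_le_one_of_one_le₀ (by linarith [Real.pi_gt_three])
  calc _ ≤ 1 * ‖∫ t : ℝ, φ t * exp (-(z * t))‖ := by gcongr
    _ ≤ _ := by rwa [one_mul]

/-- Two integrations by parts give `kern φ'' z = z² kern φ z`, and `|im z|² ≤ |z|²`. Two
exponentials appear because `re z` may have either sign; the endpoints `α`, `β` are kept since they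
later give decay rates. -/
theorem exists_norm_kern_le {φ : ℝ → ℂ} (hφ : ContDiff ℝ (⊤ : ℕ∞) φ) {α β : ℝ}
    (hs : tsupport φ ⊆ Set.Icc α β) : ∃ C : ℝ, 0 ≤ C ∧ ∀ z : ℂ,
      ‖kern φ z‖ ≤ C * (Real.exp (-(α * z.re)) + Real.exp (-(β * z.re))) / (1 + z.im ^ 2) := by
  have hc : HasCompactSupport φ := isCompact_Icc.of_isClosed_subset (isClosed_tsupport φ) hs
  have hd : ContDiff ℝ (⊤ : ℕ∞) (deriv φ) := ((contDiff_infty_iff_deriv (𝕜 := ℝ)).1 hφ).2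
  have hdd : ContDiff ℝ (⊤ : ℕ∞) (deriv (deriv φ)) := ((contDiff_infty_iff_deriv (𝕜 := ℝ)).1 hd).2
  have hs2 : tsupport (deriv (deriv φ)) ⊆ Set.Icc α β :=
    (tsupport_deriv_subset).trans (tsupport_deriv_subset.trans hs)
  refine ⟨(∫ t, ‖φ t‖) + ∫ t, ‖deriv (deriv φ) t‖, by positivity, fun z => ?_⟩
  have h1 := norm_kern_le hφ.continuous hs z
  have h2 := norm_kern_le hdd.continuous hs2 z
  rw [kern_deriv hd hc.deriv, kern_deriv hφ hc, norm_mul, norm_mul] at h2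
  rw [le_div_iff₀ (by positivity)]
  have h3 : z.im ^ 2 ≤ ‖z‖ * ‖z‖ := by
    rw [← sq, ← sq_abs]; gcongr; exact Complex.abs_im_le_norm z
  have h4 : ‖kern φ z‖ * z.im ^ 2 ≤ ‖kern φ z‖ * (‖z‖ * ‖z‖) := by gcongr
  nlinarith

theorem hasDerivAt_kern {φ : ℝ → ℂ} (hφ : Continuous φ) (hc : HasCompactSupport φ) (z₀ : ℂ) :
    HasDerivAt (kern φ) (kern (fun t => -t * φ t) z₀) z₀ := by
  obtain ⟨R, hR⟩ := hc.isBounded.subset_closedBall 0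
  have h := hasDerivAt_integral_of_dominated_loc_of_deriv_le (𝕜 := ℂ) (μ := volume)
    (F := fun (z : ℂ) (t : ℝ) => φ t * exp (-(z * t)))
    (F' := fun (z : ℂ) (t : ℝ) => φ t * (exp (-(z * t)) * (-t))) (x₀ := z₀)
    (s := Metric.ball z₀ 1) (bound := fun t => ‖φ t‖ * (Real.exp ((‖z₀‖ + 1) * |t|) * |t|))
    (Metric.ball_mem_nhds _ one_pos)
    (Eventually.of_forall fun z => (integrable_kern hφ hc z).aestronglyMeasurable)
    (integrable_kern hφ hc z₀)
    (by
      have : Continuous fun t : ℝ => φ t * (exp (-(z₀ * t)) * (-t)) := by fun_prop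
      exact this.aestronglyMeasurable)
    (Eventually.of_forall fun t z hz => by
      rw [norm_mul, norm_mul, norm_exp_neg_mul_ofReal, norm_neg, Complex.norm_real, Real.norm_eq_abs]
      gcongr
      have h1 : ‖z‖ ≤ ‖z₀‖ + 1 := by
        have := norm_le_norm_add_norm_sub' z z₀
        rw [Metric.mem_ball, dist_eq_norm] at hz
        linarith
      calc -(z.re * t) ≤ |z.re * t| := neg_le_abs _
        _ = |z.re| * |t| := abs_mul _ _
        _ ≤ (‖z₀‖ + 1) * |t| := by
          gcongr
          exact (Complex.abs_re_le_norm z).trans h1)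
    (by
      have : Continuous fun t : ℝ => ‖φ t‖ * (Real.exp ((‖z₀‖ + 1) * |t|) * |t|) := by fun_prop
      exact this.integrable_of_hasCompactSupport hc.norm.mul_right)
    (Eventually.of_forall fun t z hz => by
      have : HasDerivAt (fun w : ℂ => -(w * t)) (-(t : ℂ)) z := by
        simpa using ((hasDerivAt_id z).mul_const (t : ℂ)).fun_neg
      exact this.cexp.const_mul _)
  refine HasDerivAt.congr_deriv (f := kern φ) (h.2.const_mul (2 * Real.pi : ℂ)⁻¹) ?_
  simp only [kern]
  congr 2; ext t; ring

theorem differentiable_kern {φ : ℝ → ℂ} (hφ : Continuous φ) (hc : HasCompactSupport φ) :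
    Differentiable ℂ (kern φ) :=
  fun z => (hasDerivAt_kern hφ hc z).differentiableAt

theorem kern_translate (φ : ℝ → ℂ) (τ : ℝ) (z : ℂ) :
    kern (fun t => φ (t - τ)) z = exp (-(z * τ)) * kern φ z := by
  rw [kern, kern, mul_left_comm, ← integral_const_mul (exp (-(z * τ)))]
  congr 1
  rw [← integral_add_right_eq_self (fun t : ℝ => φ (t - τ) * exp (-(z * t))) τ]
  congr 1; ext t
  rw [mul_left_comm, ← exp_add, add_sub_cancel_right]
  congr 2
  push_cast; ring

theorem kern_mul_exp (φ : ℝ → ℂ) (w z : ℂ) :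
    kern (fun t => φ t * exp (-(w * t))) z = kern φ (z + w) := by
  rw [kern, kern]
  congr 1
  congr 1; ext t
  rw [mul_assoc, ← exp_add]
  congr 2
  ring

theorem kern_comp_mul (φ : ℝ → ℂ) {a : ℝ} (ha : 0 < a) (z : ℂ) :
    kern (fun t => φ (a * t)) z = (a : ℂ)⁻¹ * kern φ (z / a) := by
  rw [kern, kern, mul_left_comm]
  congr 1
  have h := Measure.integral_comp_mul_left (fun t : ℝ => φ t * exp (-(z / a * t))) a
  rw [abs_of_pos (inv_pos.2 ha), real_smul] at h
  push_cast at h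
  rw [← h]
  congr 1; ext t
  congr 2
  have : (a : ℂ) ≠ 0 := by exact_mod_cast ha.ne'
  field_simp

/-! ### Kernels and the inverse Fourier transform -/

/-- Fourier inversion for `invFourierSchwartz`. -/
theorem integral_invFourierSchwartz_mul_exp (ψ : 𝓢(ℝ, ℂ)) (t : ℝ) :
    ∫ s : ℝ, invFourierSchwartz ψ s * exp (-(s * I * t)) = ψ t := by
  have h : ∀ s, invFourierSchwartz ψ s
      = (2 * Real.pi : ℂ)⁻¹ * (𝓕⁻ ψ : 𝓢(ℝ, ℂ)) ((2 * Real.pi)⁻¹ * s) := fun s => rfl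
  have h2 : (𝓕 (𝓕⁻ ψ : 𝓢(ℝ, ℂ)) : 𝓢(ℝ, ℂ)) t = ψ t := by
    rw [FourierTransform.fourier_fourierInv_eq]
  rw [← h2, SchwartzMap.fourier_coe, Real.fourier_eq']
  have hs := Measure.integral_comp_mul_left (fun s : ℝ =>
    cexp (((-2 * Real.pi * inner ℝ s t : ℝ) : ℂ) * I) • (𝓕⁻ ψ : 𝓢(ℝ, ℂ)) s) (2 * Real.pi)⁻¹
  have hp : (0 : ℝ) < 2 * Real.pi := by positivity
  rw [inv_inv, abs_of_pos hp, real_smul, ← inv_mul_eq_iff_eq_mul₀ (by exact_mod_cast hp.ne')] at hs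
  rw [← hs, ← integral_const_mul]
  congr 1; ext s
  rw [h, smul_eq_mul]
  have : cexp (-(s * I * t)) =
      cexp (((-2 * Real.pi * inner ℝ ((2 * Real.pi)⁻¹ * s) t : ℝ) : ℂ) * I) := by
    congr 1
    simp only [RCLike.inner_apply, conj_trivial]
    push_cast
    have : (Real.pi : ℂ) ≠ 0 := by exact_mod_cast Real.pi_ne_zero
    field_simp
  rw [this]
  push_cast
  ring

/-- The convolution of a kernel with an inverse Fourier transform is the kernel of the product. -/
theorem integral_kern_mul_invFourierSchwartz {φ : ℝ → ℂ} (hφ : Continuous φ)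
    (hc : HasCompactSupport φ) (ψ : 𝓢(ℝ, ℂ)) (z : ℂ) :
    ∫ s : ℝ, kern φ (z + s * I) * invFourierSchwartz ψ s = kern (fun t => φ t * ψ t) z := by
  have hint : Integrable (Function.uncurry fun (s t : ℝ) =>
      invFourierSchwartz ψ s * (φ t * exp (-((z + s * I) * t)))) (volume.prod volume) := by
    have h1 : Integrable (fun p : ℝ × ℝ => invFourierSchwartz ψ p.1 * (φ p.2 * exp (-(z * p.2))))
      (volume.prod volume) :=
      (invFourierSchwartz ψ).integrable.mul_prod (integrable_kern hφ hc z)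
    refine h1.mono ?_ (Eventually.of_forall fun p => ?_)
    · refine Continuous.aestronglyMeasurable ?_
      have := (invFourierSchwartz ψ).continuous
      simp only [Function.uncurry_def]
      fun_prop
    · simp only [Function.uncurry_def, norm_mul, norm_exp_neg_mul_ofReal]
      simp
  calc ∫ s : ℝ, kern φ (z + s * I) * invFourierSchwartz ψ s
      = (2 * Real.pi : ℂ)⁻¹ * ∫ s : ℝ, ∫ t : ℝ,
          invFourierSchwartz ψ s * (φ t * exp (-((z + s * I) * t))) := by
        rw [← integral_const_mul]
        congr 1; ext s
        rw [integral_const_mul, kern]; ring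
    _ = (2 * Real.pi : ℂ)⁻¹ * ∫ t : ℝ, ∫ s : ℝ,
          invFourierSchwartz ψ s * (φ t * exp (-((z + s * I) * t))) := by
        rw [integral_integral_swap hint]
    _ = _ := by
        rw [kern]
        congr 1
        congr 1; ext t
        rw [mul_assoc, mul_left_comm, mul_comm (ψ t), ← integral_invFourierSchwartz_mul_exp ψ t, 
          ← integral_const_mul]
        congr 1; ext s
        have : -((z + s * I) * t) = -(z * t) + -(s * I * t) := by ring
        rw [this, exp_add]; ring

theorem isOpen_rightHalfPlane : IsOpen rightHalfPlane := isOpen_lt continuous_const continuous_re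

theorem exists_tsupport_subset_Icc {φ : ℝ → ℂ} (hc : HasCompactSupport φ) :
    ∃ α β : ℝ, tsupport φ ⊆ Set.Icc α β := by
  obtain ⟨R, hR⟩ := hc.isBounded.subset_closedBall 0
  exact ⟨-R, R, by simpa [Real.closedBall_eq_Icc] using hR⟩

/-- On vertical strips of finite width a kernel decays quadratically. -/
theorem exists_norm_kern_le_strip {φ : ℝ → ℂ} (hφ : ContDiff ℝ (⊤ : ℕ∞) φ)
    (hc : HasCompactSupport φ) (R : ℝ) :
    ∃ C : ℝ, 0 ≤ C ∧ ∀ z : ℂ, |z.re| ≤ R → ‖kern φ z‖ ≤ C / (1 + z.im ^ 2) := by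
  obtain ⟨α, β, hs⟩ := exists_tsupport_subset_Icc hc
  obtain ⟨C, hC, h⟩ := exists_norm_kern_le hφ hs
  refine ⟨C * (Real.exp (|α| * R) + Real.exp (|β| * R)), by positivity, fun z hz => ?_⟩
  refine (h z).trans ?_
  have key : ∀ a : ℝ, Real.exp (-(a * z.re)) ≤ Real.exp (|a| * R) := fun a =>
    Real.exp_le_exp.2 <| calc
      -(a * z.re) ≤ |a * z.re| := neg_le_abs _
      _ = |a| * |z.re| := abs_mul _ _
      _ ≤ |a| * R := by gcongr
  have := key α
  have := key β
  gcongr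

/-! ### Uniqueness from boundary values -/

/-- For a bounded holomorphic function, the pairing of the restriction to a vertical line with a
kernel agrees with the pairing of the boundary function. -/
theorem integral_mul_kern_eq_boundary {H : ℂ → ℂ} (hd : DifferentiableOn ℂ H rightHalfPlane) {M : ℝ}
    (hM : ∀ z ∈ rightHalfPlane, ‖H z‖ ≤ M) {D : ℝ → ℂ}
    (hD : ∀ᵐ s : ℝ, Tendsto (fun t : ℝ => H (t + s * I)) (𝓝[>] 0) (𝓝 (D s)))
    {ψ : ℝ → ℂ} (hψ : ContDiff ℝ (⊤ : ℕ∞) ψ) (hc : HasCompactSupport ψ) {x : ℝ} (hx : 0 < x) :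
    ∫ s : ℝ, H (x + s * I) * kern ψ (-(x + s * I)) = ∫ s : ℝ, D s * kern ψ (-(s * I)) := by
  have hk := differentiable_kern hψ.continuous hc
  obtain ⟨C, hC, hb⟩ := exists_norm_kern_le_strip hψ hc x
  have hM0 : 0 ≤ M := (norm_nonneg _).trans (hM 1 (by simp [rightHalfPlane]))
  have hbound : ∀ t ∈ Set.Ioc 0 x, ∀ s : ℝ,
      ‖H (t + s * I) * kern ψ (-(t + s * I))‖ ≤ M * C / (1 + s ^ 2) := by
    intro t ht s
    have h1 := hb (-(t + s * I)) (by simpa [abs_of_pos ht.1] using ht.2)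
    have h2 := hM (t + s * I) (by simpa [rightHalfPlane] using ht.1)
    simp only [neg_im, add_im, ofReal_im, mul_im, ofReal_re, I_im, mul_one, I_re, mul_zero,
      add_zero, zero_add, neg_sq] at h1
    rw [norm_mul, mul_div_assoc]
    gcongr
  have hconst : ∀ t ∈ Set.Ioc 0 x, ∫ s : ℝ, H (t + s * I) * kern ψ (-(t + s * I)) =
      ∫ s : ℝ, H (x + s * I) * kern ψ (-(x + s * I)) := by
    intro t ht
    refine integral_vertical_eq (H := fun z => H z * kern ψ (-z)) (C := M * C) ht.2 ?_ ?_
    · refine (hd.mono ?_).mul (hk.comp differentiable_neg).differentiableOn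
      intro z hz
      exact lt_of_lt_of_le ht.1 hz.1
    · exact fun r hr => hbound r ⟨ht.1.trans_le hr.1, hr.2⟩
  have hlim : Tendsto (fun t : ℝ => ∫ s : ℝ, H (t + s * I) * kern ψ (-(t + s * I))) (𝓝[>] 0)
      (𝓝 (∫ s : ℝ, D s * kern ψ (-(s * I)))) := by
    refine tendsto_integral_filter_of_dominated_convergence (fun s => M * C / (1 + s ^ 2)) ?_ ?_
      (integrable_const_div_one_add_sq _) ?_
    · filter_upwards [self_mem_nhdsWithin] with t ht
      refine Continuous.aestronglyMeasurable (Continuous.mul ?_ ?_)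
      · exact vertical_continuous hd.continuousOn fun y => by simpa [rightHalfPlane] using ht
      · exact hk.continuous.comp (by fun_prop)
    · filter_upwards [Ioc_mem_nhdsGT hx] with t ht
      exact Eventually.of_forall (hbound t ht)
    · filter_upwards [hD] with s hs
      refine hs.mul ?_
      have : Continuous fun t : ℝ => kern ψ (-(t + s * I)) := hk.continuous.comp (by fun_prop)
      simpa using (this.tendsto 0).mono_left nhdsWithin_le_nhds
  refine tendsto_nhds_unique (tendsto_const_nhds.congr' ?_) hlim
  filter_upwards [Ioc_mem_nhdsGT hx] with t ht
  exact (hconst t ht).symm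

theorem eq_zero_of_fourier_eq_zero {h : ℝ → ℂ} (hcont : Continuous h) (hi : Integrable h)
    (h0 : ∀ τ : ℝ, ∫ s : ℝ, h s * exp (s * I * τ) = 0) : h = 0 := by
  have hF : 𝓕 h = 0 := by
    ext τ
    rw [Real.fourier_eq', Pi.zero_apply, ← h0 (-2 * Real.pi * τ)]
    congr 1; ext s
    rw [smul_eq_mul, mul_comm]
    congr 2
    simp only [RCLike.inner_apply, conj_trivial]
    push_cast; ring
  have := hcont.fourierInv_fourier_eq hi (by rw [hF]; exact integrable_zero _ _ _)
  rw [← this, hF]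
  ext v
  simp [Real.fourierInv_eq']

/-- A bounded holomorphic function whose boundary function annihilates all kernels vanishes. -/
theorem eq_zero_of_boundary_annihilates {H : ℂ → ℂ} (hd : DifferentiableOn ℂ H rightHalfPlane)
    {M : ℝ} (hM : ∀ z ∈ rightHalfPlane, ‖H z‖ ≤ M) {D : ℝ → ℂ}
    (hD : ∀ᵐ s : ℝ, Tendsto (fun t : ℝ => H (t + s * I)) (𝓝[>] 0) (𝓝 (D s)))
    (h0 : ∀ ψ : ℝ → ℂ, ContDiff ℝ (⊤ : ℕ∞) ψ → HasCompactSupport ψ →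
      ∫ s : ℝ, D s * kern ψ (-(s * I)) = 0) {w : ℂ} (hw : w ∈ rightHalfPlane) : H w = 0 := by
  have hx : 0 < w.re := hw
  have main : ∀ ψ : ℝ → ℂ, ContDiff ℝ (⊤ : ℕ∞) ψ → HasCompactSupport ψ →
      (fun s : ℝ => H (w.re + s * I) * kern ψ (-(w.re + s * I))) = 0 := by
    intro ψ hψ hc
    have hk := differentiable_kern hψ.continuous hc
    have hcont : Continuous fun s : ℝ => H (w.re + s * I) * kern ψ (-(w.re + s * I)) :=
      (vertical_continuous hd.continuousOn fun y => by simpa [rightHalfPlane] using hx).mul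
        (hk.continuous.comp (by fun_prop))
    obtain ⟨C, hC, hb⟩ := exists_norm_kern_le_strip hψ hc w.re
    refine eq_zero_of_fourier_eq_zero hcont ?_ fun τ => ?_
    · refine (integrable_const_div_one_add_sq (M * C)).mono' hcont.aestronglyMeasurable
        (Eventually.of_forall fun s => ?_)
      have h1 := hb (-(w.re + s * I)) (by simp [abs_of_pos hx])
      have h2 := hM (w.re + s * I) (by simpa [rightHalfPlane] using hx)
      simp only [neg_im, add_im, ofReal_im, mul_im, ofReal_re, I_im, mul_one, I_re, mul_zero,
        add_zero, zero_add, neg_sq] at h1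
      rw [norm_mul, mul_div_assoc]
      exact mul_le_mul h2 h1 (norm_nonneg _) ((norm_nonneg _).trans h2)
    -- Translating `ψ` by `τ` multiplies `kern ψ (-z)` by `exp (z τ)`, so the hypothesis for all
    -- translates says that every Fourier coefficient of the product on the line vanishes.
    · have hψ' : ContDiff ℝ (⊤ : ℕ∞) fun t => ψ (t - τ) := hψ.comp (by fun_prop)
      have hc' : HasCompactSupport fun t => ψ (t - τ) := by
        simpa [sub_eq_add_neg, Function.comp_def] using hc.comp_homeomorph (Homeomorph.addRight (-τ))
      have := integral_mul_kern_eq_boundary hd hM hD hψ' hc' hx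
      rw [h0 _ hψ' hc'] at this
      have h3 : ∫ s : ℝ, exp (w.re * τ) *
          (H (w.re + s * I) * kern ψ (-(w.re + s * I)) * exp (s * I * τ)) = 0 := by
        rw [← this]
        congr 1; ext s
        rw [kern_translate]
        have : -(-(w.re + s * I) * τ) = w.re * τ + s * I * τ := by ring
        rw [this, exp_add]
        ring
      rw [integral_const_mul] at h3
      exact (mul_eq_zero.mp h3).resolve_left (exp_ne_zero _)
  -- The twist of `χ` by `exp (-(w t))` moves the argument `-w` of the kernel to `0`, where the
  -- kernel of `χ` is `(2π)⁻¹ ∫ χ ≠ 0`.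
  let χ : ContDiffBump (0 : ℝ) := ⟨1, 2, one_pos, one_lt_two⟩
  have hχ : ContDiff ℝ (⊤ : ℕ∞) fun t => (χ t : ℂ) := ofRealCLM.contDiff.comp χ.contDiff
  have hχc : HasCompactSupport fun t => (χ t : ℂ) :=
    χ.hasCompactSupport.comp_left (g := fun r : ℝ => (r : ℂ)) rfl
  have hexp : ContDiff ℝ (⊤ : ℕ∞) fun t : ℝ => exp (-(w * t)) :=
    Complex.contDiff_exp.comp (contDiff_const.mul ofRealCLM.contDiff).neg
  have h1 := congrFun (main (fun t => χ t * exp (-(w * t))) (hχ.mul hexp) hχc.mul_right) w.im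
  simp only [re_add_im, Pi.zero_apply] at h1
  rw [kern_mul_exp, neg_add_cancel] at h1
  refine (mul_eq_zero.mp h1).resolve_right ?_
  have : kern (fun t => (χ t : ℂ)) 0 = (2 * Real.pi : ℂ)⁻¹ * ((∫ t, χ t : ℝ) : ℂ) := by
    simp only [kern, zero_mul, neg_zero, exp_zero, mul_one]
    rw [integral_complex_ofReal]
  rw [this]
  have h2 : (∫ t, χ t : ℝ) ≠ 0 := χ.integral_pos.ne'
  have h3 : (Real.pi : ℂ) ≠ 0 := by exact_mod_cast Real.pi_ne_zero
  have h4 : ((∫ t, χ t : ℝ) : ℂ) ≠ 0 := by exact_mod_cast h2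
  exact mul_ne_zero (inv_ne_zero (mul_ne_zero two_ne_zero h3)) h4

/-! ### Cutoffs and supports of distributions -/

open scoped Manifold in
theorem exists_cutoff {s t : Set ℝ} (hs : IsClosed s) (ht : IsClosed t) (hd : Disjoint s t) :
    ∃ χ : ℝ → ℂ, ContDiff ℝ (⊤ : ℕ∞) χ ∧ Disjoint (tsupport χ) s ∧
      Disjoint (tsupport fun x => 1 - χ x) t := by
  obtain ⟨f, h0, h1, -⟩ := exists_contMDiffMap_zero_one_nhds_of_isClosed (n := (⊤ : ℕ∞))
    𝓘(ℝ, ℝ) hs ht hd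
  refine ⟨fun x => (f x : ℂ), ofRealCLM.contDiff.comp f.contMDiff.contDiff, ?_, ?_⟩
  · rw [Set.disjoint_right]
    intro x hx
    rw [notMem_tsupport_iff_eventuallyEq]
    filter_upwards [eventually_nhdsSet_iff_forall.1 h0 x hx] with y hy
    simp [hy]
  · rw [Set.disjoint_right]
    intro x hx
    rw [notMem_tsupport_iff_eventuallyEq]
    filter_upwards [eventually_nhdsSet_iff_forall.1 h1 x hx] with y hy
    simp [hy]

/-- A tempered distribution vanishes on compactly supported test functions whose support does
not meet the support of the distribution. -/
theorem apply_eq_zero_of_disjoint_dsupport (u : 𝓢'(ℝ, ℂ)) (ψ : 𝓢(ℝ, ℂ))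
    (hc : HasCompactSupport ψ) (hd : Disjoint (tsupport ψ) (Distribution.dsupport u)) :
    u ψ = 0 := by
  suffices ∃ V, tsupport ψ ⊆ V ∧ IsOpen V ∧
      ∀ ψ : 𝓢(ℝ, ℂ), HasCompactSupport ψ → tsupport ψ ⊆ V → u ψ = 0 by
    obtain ⟨V, hV, -, h⟩ := this
    exact h ψ hc hV
  refine IsCompact.induction_on (p := fun s => ∃ V, s ⊆ V ∧ IsOpen V ∧
      ∀ ψ : 𝓢(ℝ, ℂ), HasCompactSupport ψ → tsupport ψ ⊆ V → u ψ = 0) hc ?_ ?_ ?_ ?_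
  · refine ⟨∅, le_rfl, isOpen_empty, fun ψ _ h => ?_⟩
    have : ψ = 0 := by
      ext x
      exact image_eq_zero_of_notMem_tsupport fun hx => h hx
    simp [this]
  · rintro s t hst ⟨V, hV, h⟩
    exact ⟨V, hst.trans hV, h⟩
  · rintro s t ⟨V₁, hs, ho₁, h₁⟩ ⟨V₂, ht, ho₂, h₂⟩
    refine ⟨V₁ ∪ V₂, Set.union_subset_union hs ht, ho₁.union ho₂, fun ψ hψ hsub => ?_⟩
    -- Take `χ = 0` near the complement of `V₁` and `χ = 1` near the part of the support of `ψ`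
    -- outside `V₂`. Then `χ ψ` is supported in `V₁` and `(1 - χ) ψ` in `V₂`.
    obtain ⟨χ, hχ, hχ0, hχ1⟩ := exists_cutoff ho₁.isClosed_compl
      ((isClosed_tsupport ψ).inter ho₂.isClosed_compl) (by
        rw [Set.disjoint_left]
        rintro x hx ⟨hx1, hx2⟩
        exact (hsub hx1).elim hx hx2)
    have hc1 : HasCompactSupport fun x => χ x * ψ x := hψ.mul_left
    have hc2 : HasCompactSupport fun x => (1 - χ x) * ψ x := hψ.mul_left
    obtain ⟨a, ha⟩ : ∃ a : 𝓢(ℝ, ℂ), ∀ x, a x = χ x * ψ x :=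
      ⟨hc1.toSchwartzMap (hχ.mul ψ.smooth'), fun _ => rfl⟩
    obtain ⟨b, hb⟩ : ∃ b : 𝓢(ℝ, ℂ), ∀ x, b x = (1 - χ x) * ψ x :=
      ⟨hc2.toSchwartzMap ((contDiff_const.sub hχ).mul ψ.smooth'), fun _ => rfl⟩
    have e : ψ = a + b := by
      ext x
      rw [add_apply, ha, hb]
      ring
    have e' : u ψ = u a + u b := by rw [← map_add, ← e]
    rw [← funext ha] at hc1
    rw [← funext hb] at hc2
    rw [e', h₁ a hc1 ?_, h₂ b hc2 ?_, add_zero]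
    rw [funext hb]
    on_goal 2 => rw [funext ha]
    · intro x hx
      by_contra hxV
      exact Set.disjoint_left.1 hχ1 (tsupport_mul_subset_left hx)
        ⟨tsupport_mul_subset_right hx, hxV⟩
    · intro x hx
      by_contra hxV
      exact Set.disjoint_left.1 hχ0 (tsupport_mul_subset_left hx) hxV
  · intro x hx
    obtain ⟨V, hV, hVo, hxV⟩ := (Distribution.notMem_dsupport_iff x).1 (Set.disjoint_left.1 hd hx)
    exact ⟨V, mem_nhdsWithin_of_mem_nhds (hVo.mem_nhds hxV), V, le_rfl, hVo,
      fun ψ _ h => hV ψ h⟩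

/-! ### Convolution with a kernel as a spectral multiplier -/

theorem kern_sub_vertical_continuous {φ : ℝ → ℂ} (hφ : Continuous φ) (hc : HasCompactSupport φ)
    (w : ℂ) : Continuous fun r : ℝ => kern φ (w - r * I) :=
  (differentiable_kern hφ hc).continuous.comp (by fun_prop)

theorem integrable_const_div_one_add_sq_comp (C y : ℝ) :
    Integrable fun r : ℝ => C / (1 + (y - r) ^ 2) :=
  (integrable_const_div_one_add_sq C).comp_sub_left y

/-- Convolution along the imaginary axis of a function with a kernel. -/
def kernConv (φ g : ℝ → ℂ) (w : ℂ) : ℂ := ∫ r : ℝ, g r * kern φ (w - r * I)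

theorem integrable_kernConv {φ : ℝ → ℂ} (hφ : ContDiff ℝ (⊤ : ℕ∞) φ) (hc : HasCompactSupport φ)
    {g : ℝ → ℂ} {M : ℝ} (hg : AEStronglyMeasurable g volume) (hM : ∀ᵐ r, ‖g r‖ ≤ M)
    (w : ℂ) : Integrable fun r : ℝ => g r * kern φ (w - r * I) := by
  obtain ⟨C, hC, hb⟩ := exists_norm_kern_le_strip hφ hc |w.re|
  refine (integrable_const_div_one_add_sq_comp (M * C) w.im).mono'
    (hg.mul (kern_sub_vertical_continuous hφ.continuous hc w).aestronglyMeasurable) ?_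
  filter_upwards [hM] with r hr
  have h1 := hb (w - r * I) (by simp)
  simp only [sub_im, mul_im, ofReal_re, I_im, mul_one, ofReal_im, I_re, mul_zero, add_zero] at h1
  rw [norm_mul, mul_div_assoc]
  exact mul_le_mul hr h1 (norm_nonneg _) ((norm_nonneg _).trans hr)

theorem differentiable_kernConv {φ : ℝ → ℂ} (hφ : ContDiff ℝ (⊤ : ℕ∞) φ) (hc : HasCompactSupport φ)
    {g : ℝ → ℂ} {M : ℝ} (hg : AEStronglyMeasurable g volume) (hM : ∀ᵐ r, ‖g r‖ ≤ M) :
    Differentiable ℂ (kernConv φ g) := by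
  intro w₀
  have hφ' : ContDiff ℝ (⊤ : ℕ∞) fun t : ℝ => -(t : ℂ) * φ t := ofRealCLM.contDiff.neg.mul hφ
  have hc' : HasCompactSupport fun t : ℝ => -(t : ℂ) * φ t := hc.mul_left
  obtain ⟨C, hC, hb⟩ := exists_norm_kern_le_strip hφ' hc' (|w₀.re| + 1)
  have h := hasDerivAt_integral_of_dominated_loc_of_deriv_le (𝕜 := ℂ) (μ := volume)
    (F := fun (w : ℂ) (r : ℝ) => g r * kern φ (w - r * I))
    (F' := fun (w : ℂ) (r : ℝ) => g r * kern (fun t : ℝ => -(t : ℂ) * φ t) (w - r * I)) (x₀ := w₀)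
    (s := Metric.ball w₀ 1) (bound := fun r => (3 * M * C) / (1 + (w₀.im - r) ^ 2))
    (Metric.ball_mem_nhds _ one_pos)
    (Eventually.of_forall fun w => (integrable_kernConv hφ hc hg hM w).aestronglyMeasurable)
    (integrable_kernConv hφ hc hg hM w₀)
    (hg.mul (kern_sub_vertical_continuous hφ'.continuous hc' w₀).aestronglyMeasurable)
    (by
      filter_upwards [hM] with r hr w hw
      rw [Metric.mem_ball, dist_eq_norm] at hw
      have hre : |w.re - w₀.re| ≤ 1 := by
        have := (abs_re_le_norm (w - w₀)).trans hw.le; simpa using this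
      have him : |w.im - w₀.im| ≤ 1 := by
        have := (abs_im_le_norm (w - w₀)).trans hw.le; simpa using this
      have h1 := hb (w - r * I) (by
        simp only [sub_re, mul_re, ofReal_re, I_re, mul_zero, ofReal_im, I_im, mul_one, sub_zero]
        have := abs_sub_abs_le_abs_sub w.re w₀.re
        linarith)
      simp only [sub_im, mul_im, ofReal_re, I_im, mul_one, ofReal_im, I_re, mul_zero,
        add_zero] at h1
      rw [norm_mul]
      refine (mul_le_mul hr h1 (norm_nonneg _) ((norm_nonneg _).trans hr)).trans ?_
      rw [← mul_div_assoc, div_le_div_iff₀ (by positivity) (by positivity)]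
      -- This is the origin of the factor `3` in the majorant: moving `w` by at most `1` changes the
      -- weight by a bounded factor.
      have h2 : 1 + (w₀.im - r) ^ 2 ≤ 3 * (1 + (w.im - r) ^ 2) := by
        have := abs_le.1 him
        nlinarith [sq_nonneg ((w.im - r) + (w.im - w₀.im))]
      have h3 : 0 ≤ M * C := mul_nonneg ((norm_nonneg _).trans hr) hC
      nlinarith [mul_le_mul_of_nonneg_left h2 h3])
    (integrable_const_div_one_add_sq_comp _ _)
    (Eventually.of_forall fun r w _ => by
      have h1 := hasDerivAt_kern hφ.continuous hc (w - r * I)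
      have h2 : HasDerivAt (fun w : ℂ => w - r * I) 1 w := (hasDerivAt_id w).sub_const _
      simpa using (h1.comp w h2).const_mul (g r))
  exact h.2.differentiableAt

theorem exists_norm_kernConv_le {φ : ℝ → ℂ} (hφ : ContDiff ℝ (⊤ : ℕ∞) φ) {M : ℝ} (hM0 : 0 ≤ M)
    {α β : ℝ} (hs : tsupport φ ⊆ Set.Icc α β) :
    ∃ C : ℝ, 0 ≤ C ∧ ∀ g : ℝ → ℂ, (∀ᵐ r, ‖g r‖ ≤ M) → ∀ w : ℂ,
      ‖kernConv φ g w‖ ≤ C * (Real.exp (-(α * w.re)) + Real.exp (-(β * w.re))) := by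
  obtain ⟨C, hC, hb⟩ := exists_norm_kern_le hφ hs
  refine ⟨M * C * ∫ r : ℝ, (1 + r ^ 2)⁻¹, by
    have : 0 ≤ ∫ r : ℝ, (1 + r ^ 2)⁻¹ := integral_nonneg fun r => by positivity
    positivity, fun g hM w => ?_⟩
  set E := Real.exp (-(α * w.re)) + Real.exp (-(β * w.re))
  have h1 : ‖kernConv φ g w‖ ≤ ∫ r : ℝ, M * C * E / (1 + (w.im - r) ^ 2) := by
    refine norm_integral_le_of_norm_le (integrable_const_div_one_add_sq_comp _ _) ?_
    filter_upwards [hM] with r hr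
    have h1 := hb (w - r * I)
    simp only [sub_im, mul_im, ofReal_re, I_im, mul_one, ofReal_im, I_re, mul_zero, add_zero,
      sub_re, mul_re, sub_zero] at h1
    rw [norm_mul]
    refine (mul_le_mul hr h1 (norm_nonneg _) hM0).trans (le_of_eq ?_)
    ring
  refine h1.trans (le_of_eq ?_)
  rw [integral_sub_left_eq_self (fun r : ℝ => M * C * E / (1 + r ^ 2)) volume w.im]
  simp only [div_eq_mul_inv]
  rw [integral_const_mul]
  ring

/-- Associativity of the convolution with an inverse Fourier transform. -/
theorem integral_kernConv_mul_invFourierSchwartz {φ : ℝ → ℂ} (hφ : ContDiff ℝ (⊤ : ℕ∞) φ) (hc : HasCompactSupport φ)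
    {g : ℝ → ℂ} {M : ℝ} (hg : AEStronglyMeasurable g volume) (hM : ∀ᵐ r, ‖g r‖ ≤ M)
    (ψ : 𝓢(ℝ, ℂ)) (w : ℂ) :
    ∫ s : ℝ, kernConv φ g (w + s * I) * invFourierSchwartz ψ s =
      kernConv (fun t => φ t * ψ t) g w := by
  obtain ⟨C, hC, hb⟩ := exists_norm_kern_le_strip hφ hc |w.re|
  have hint : Integrable (Function.uncurry fun (r s : ℝ) =>
      g r * (kern φ (w - r * I + s * I) * invFourierSchwartz ψ s)) (volume.prod volume) := by
    have h1 := Integrable.convolution_integrand (ContinuousLinearMap.mul ℝ ℝ)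
      ((invFourierSchwartz ψ).integrable (μ := volume)).norm (integrable_const_div_one_add_sq_comp (M * C) w.im)
    refine h1.mono' ?_ ?_
    · have h2 : AEStronglyMeasurable (fun p : ℝ × ℝ => g p.1) (volume.prod volume) := hg.comp_fst
      refine h2.mul (Continuous.aestronglyMeasurable ?_)
      exact ((differentiable_kern hφ.continuous hc).continuous.comp (by fun_prop)).mul
        ((invFourierSchwartz ψ).continuous.comp continuous_snd)
    · have : ∀ᵐ p : ℝ × ℝ ∂(volume.prod volume), ‖g p.1‖ ≤ M :=
        Measure.quasiMeasurePreserving_fst.ae hM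
      filter_upwards [this] with p hp
      have h1 := hb (w - p.1 * I + p.2 * I) (by simp)
      simp only [sub_im, mul_im, ofReal_re, I_im, mul_one, ofReal_im, I_re, mul_zero, add_zero,
        add_im] at h1
      simp only [Function.uncurry_def, norm_mul, ContinuousLinearMap.mul_apply']
      rw [mul_comm ‖kern φ _‖, mul_left_comm]
      gcongr
      rw [mul_div_assoc]
      refine mul_le_mul hp (h1.trans (le_of_eq ?_)) (norm_nonneg _) ((norm_nonneg _).trans hp)
      ring
  calc ∫ s : ℝ, kernConv φ g (w + s * I) * invFourierSchwartz ψ s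
      = ∫ s : ℝ, ∫ r : ℝ, g r * (kern φ (w - r * I + s * I) * invFourierSchwartz ψ s) := by
        congr 1; ext s
        rw [kernConv, ← integral_mul_const]
        congr 1; ext r
        rw [mul_assoc, add_sub_right_comm]
    _ = ∫ r : ℝ, ∫ s : ℝ, g r * (kern φ (w - r * I + s * I) * invFourierSchwartz ψ s) :=
        (integral_integral_swap hint).symm
    _ = _ := by
        rw [kernConv]
        congr 1; ext r
        rw [integral_const_mul, integral_kern_mul_invFourierSchwartz hφ.continuous hc]

/-- Turns support conditions on the inverse Fourier transform into vanishing of convolutions at the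
origin. -/
theorem invFourier_toTemperedDistribution_apply (g : Lp ℂ ∞ (volume : Measure ℝ)) (ψ : 𝓢(ℝ, ℂ)) :
    invFourier (Lp.toTemperedDistribution g) ψ = kernConv ψ g 0 := by
  rw [invFourier_apply, Lp.toTemperedDistribution_apply, kernConv]
  congr 1; ext r
  rw [invFourierSchwartz_eq_kern, zero_sub, smul_eq_mul, mul_comm]

theorem ae_norm_le_Linfty (g : Lp ℂ ∞ (volume : Measure ℝ)) : ∀ᵐ r, ‖g r‖ ≤ ‖g‖ := by
  have h := ae_le_eLpNormEssSup (f := g) (μ := volume)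
  filter_upwards [h] with r hr
  rw [Lp.norm_def, eLpNorm_exponent_top, ← toReal_enorm]
  exact ENNReal.toReal_mono (by
    rw [← eLpNorm_exponent_top]; exact (Lp.memLp g).2.ne) hr

/-! ### Spectrum in `[ε, δ]` forces exponential decay: `𝒢 ⊆ 𝓑₀` -/

/-- A function with spectrum in `[ε, δ]` extends to an entire function which decays
exponentially to the right. -/
theorem exists_entire_extension {ε δ : ℝ} (hε : 0 < ε) (hεδ : ε < δ) {f : ℂ → ℂ}
    (hf : f ∈ spectralSubspace (Set.Icc ε δ)) :
    ∃ G : ℂ → ℂ, Differentiable ℂ G ∧ Set.EqOn f G rightHalfPlane ∧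
      ∃ C : ℝ, 0 ≤ C ∧ ∀ w : ℂ, -1 ≤ w.re → ‖G w‖ ≤ C * Real.exp (-(ε / 2 * w.re)) := by
  obtain ⟨⟨hd, M, hM⟩, g, hbd, hsupp⟩ := hf
  -- `η = 1` near the spectrum, and its support stays to the right of `ε / 2`, which becomes the
  -- decay rate.
  obtain ⟨η, hη, hη0, hη1⟩ := exists_cutoff (s := (Set.Ioo (ε / 2) (2 * δ))ᶜ) (t := Set.Icc ε δ)
    isOpen_Ioo.isClosed_compl isClosed_Icc (by
      rw [Set.disjoint_left]
      rintro x hx hx'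
      exact hx ⟨by linarith [hx'.1], by linarith [hx'.2]⟩)
  have hs : tsupport η ⊆ Set.Icc (ε / 2) (2 * δ) :=
    (Set.disjoint_compl_right_iff_subset.1 hη0).trans Set.Ioo_subset_Icc_self
  have hc : HasCompactSupport η := isCompact_Icc.of_isClosed_subset (isClosed_tsupport η) hs
  have hgm := Lp.aestronglyMeasurable g
  have hgb := ae_norm_le_Linfty g
  have hG := differentiable_kernConv hη hc hgm hgb
  obtain ⟨C, hC, hb⟩ := exists_norm_kernConv_le hη (norm_nonneg g) hs
  replace hb := hb g hgb
  -- The bound reaches `re w = -1` so that unit circles centred in `ℂ₊` are available for Cauchy's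
  -- estimate on `f'`.
  have hbound : ∀ w : ℂ, -1 ≤ w.re →
      ‖kernConv η g w‖ ≤ (C * (1 + Real.exp (2 * δ))) * Real.exp (-(ε / 2 * w.re)) := by
    intro w hw
    refine (hb w).trans ?_
    have h1 : Real.exp (-(2 * δ * w.re)) ≤
        Real.exp (2 * δ) * Real.exp (-(ε / 2 * w.re)) := by
      rw [← Real.exp_add]
      gcongr
      nlinarith
    refine (mul_le_mul_of_nonneg_left (add_le_add_right h1 _) hC).trans (le_of_eq ?_)
    ring
  refine ⟨kernConv η g, hG, fun w hw => ?_, _, by positivity, hbound⟩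
  refine sub_eq_zero.1 (eq_zero_of_boundary_annihilates (H := fun z => f z - kernConv η g z)
    (M := M + C * (1 + Real.exp (2 * δ))) (D := fun s => g s - kernConv η g (s * I))
    (hd.sub hG.differentiableOn) ?_ ?_ ?_ hw)
  · intro z hz
    have hz' : 0 < z.re := hz
    refine (norm_sub_le _ _).trans (add_le_add (hM z hz) ((hbound z (by linarith)).trans ?_))
    refine mul_le_of_le_one_right (by positivity) (Real.exp_le_one_iff.2 ?_)
    have : 0 < ε / 2 * z.re := by positivity
    linarith
  · filter_upwards [hbd] with s hs
    refine hs.sub ?_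
    have : Continuous fun t : ℝ => kernConv η g (t + s * I) := hG.continuous.comp (by fun_prop)
    simpa using (this.tendsto 0).mono_left nhdsWithin_le_nhds
  · intro ψ hψ hψc
    have hcη : HasCompactSupport fun t => η t * ψ t := hc.mul_right
    have hc1 : HasCompactSupport fun t => (1 - η t) * ψ t := hψc.mul_left
    have e3 := integral_kernConv_mul_invFourierSchwartz hη hc hgm hgb (hψc.toSchwartzMap hψ) 0
    -- `(1 - η) ψ` vanishes near `[ε, δ]`, so the distribution annihilates it: `ψ` and `η ψ` have
    -- the same pairing, that is, `g` and its convolution with `kern η` have the same pairing with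
    -- `kern ψ`.
    have e4 := apply_eq_zero_of_disjoint_dsupport (invFourier (Lp.toTemperedDistribution g))
      (hc1.toSchwartzMap ((contDiff_const.sub hη).mul hψ)) hc1 (by
        rw [Set.disjoint_left]
        intro x hx hx'
        exact Set.disjoint_left.1 hη1 (tsupport_mul_subset_left hx) (hsupp hx'))
    rw [invFourier_toTemperedDistribution_apply] at e4
    simp only [HasCompactSupport.toSchwartzMap_toFun, zero_add, invFourierSchwartz_eq_kern] at e3 e4
    have i1 := integrable_kernConv hψ hψc hgm hgb 0
    have i2 := integrable_kernConv (hη.mul hψ) hcη hgm hgb 0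
    have i3 : Integrable fun s : ℝ => kernConv η g (s * I) * kern ψ (-(s * I)) := by
      have := (integrable_kernConv hψ hψc
        (g := fun s : ℝ => kernConv η g (s * I)) (M := C * (1 + 1))
        (hG.continuous.comp (by fun_prop)).aestronglyMeasurable
        (Eventually.of_forall fun s => by simpa using hb (s * I)) 0)
      simpa using this
    have i4 : Integrable fun s : ℝ => g s * kern ψ (-(s * I)) := by simpa using i1
    simp only [sub_mul]
    rw [integral_sub i4 i3]
    have e3' : ∫ s : ℝ, kernConv η g (s * I) * kern ψ (-(s * I)) =
      kernConv (fun t => η t * ψ t) g 0 := e3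
    have e4' : kernConv (fun t => (1 - η t) * ψ t) g 0 = 0 := e4
    rw [e3']
    refine Eq.trans ?_ e4'
    rw [kernConv, kernConv, ← integral_sub i4 i2]
    congr 1; ext r
    have : (fun t => (1 - η t) * ψ t) = fun t => ψ t - η t * ψ t := by ext t; ring
    rw [this, kern_sub hψ.continuous hψc (hη.mul hψ).continuous hcη, zero_sub]
    ring

theorem deriv_eq_of_eqOn {f G : ℂ → ℂ} (h : Set.EqOn f G rightHalfPlane) {z : ℂ}
    (hz : z ∈ rightHalfPlane) : deriv f z = deriv G z :=
  (h.eventuallyEq_of_mem (isOpen_rightHalfPlane.mem_nhds hz)).deriv_eq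

theorem spectralUnion_subset_besovZero : spectralUnion ⊆ besovZero := by
  rintro f ⟨ε, δ, hε, hεδ, hf⟩
  obtain ⟨G, hG, hfG, C, hC, hb⟩ := exists_entire_extension hε hεδ hf
  refine ⟨⟨hf.1.1, ?_⟩, ?_⟩
  · have hderiv : ∀ x : ℝ, 0 < x → ∀ y : ℝ,
        ‖deriv f (x + y * I)‖ ≤ C * Real.exp (ε / 2) * Real.exp (-(ε / 2) * x) := by
      intro x hx y
      rw [deriv_eq_of_eqOn hfG (by simpa [rightHalfPlane] using hx)]
      have := norm_deriv_le_of_forall_mem_sphere_norm_le (f := G) (c := x + y * I) one_pos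
        hG.diffContOnCl (C := C * Real.exp (ε / 2) * Real.exp (-(ε / 2) * x)) (by
          intro z hz
          have h1 : x - 1 ≤ z.re := by
            have h2 := (abs_re_le_norm (z - (x + y * I))).trans (mem_sphere_iff_norm.1 hz).le
            simp only [sub_re, add_re, ofReal_re, mul_re, I_re, mul_zero, ofReal_im, I_im, mul_one,
              sub_self, add_zero] at h2
            linarith [(abs_le.1 h2).1]
          refine (hb z (by linarith)).trans ?_
          rw [mul_assoc, ← Real.exp_add]
          gcongr
          nlinarith)
      simpa using this
    have hint : IntegrableOn (fun x => C * Real.exp (ε / 2) * Real.exp (-(ε / 2) * x))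
        (Set.Ioi 0) := (exp_neg_integrableOn_Ioi 0 (by positivity)).const_mul _
    refine lt_of_le_of_lt ?_ hint.lintegral_lt_top
    refine setLIntegral_mono_ae (by fun_prop) (Eventually.of_forall fun x hx => ?_)
    refine iSup_le fun y => ?_
    rw [← ofReal_norm]
    exact ENNReal.ofReal_le_ofReal (hderiv x hx y)
  · have h1 : Tendsto (fun x : ℝ => C * Real.exp (-(ε / 2 * x))) atTop (𝓝 0) := by
      rw [← mul_zero C]
      refine Tendsto.const_mul _ (Real.tendsto_exp_neg_atTop_nhds_zero.comp ?_)
      exact tendsto_id.const_mul_atTop (by positivity)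
    refine squeeze_zero_norm' ?_ (h1.comp tendsto_comap)
    filter_upwards [preimage_mem_comap (Ioi_mem_atTop 0)] with z hz
    have hz' : 0 < z.re := hz
    rw [hfG hz]
    exact hb z (by linarith)

/-! ### Spectral multipliers on bounded holomorphic functions -/

theorem add_mul_I_mem_rightHalfPlane {x : ℝ} (hx : 0 < x) (y : ℝ) :
    (x + y * I : ℂ) ∈ rightHalfPlane := by
  simpa [rightHalfPlane] using hx

theorem nonneg_of_norm_le_on_rightHalfPlane {f : ℂ → ℂ} {M : ℝ}
    (hM : ∀ z ∈ rightHalfPlane, ‖f z‖ ≤ M) : 0 ≤ M :=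
  (norm_nonneg _).trans (hM 1 (by simp [rightHalfPlane]))

/-- The convolution of a bounded holomorphic function with a kernel may be computed along any
vertical line. -/
theorem kernConv_vertical_eq {f : ℂ → ℂ} (hd : DifferentiableOn ℂ f rightHalfPlane) {M : ℝ}
    (hM : ∀ z ∈ rightHalfPlane, ‖f z‖ ≤ M) {φ : ℝ → ℂ} (hφ : ContDiff ℝ (⊤ : ℕ∞) φ)
    (hc : HasCompactSupport φ) (w : ℂ) {x₁ x₂ : ℝ} (h₁ : 0 < x₁) (h₂ : 0 < x₂) :
    kernConv φ (fun r => f (x₁ + r * I)) (w - x₁) =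
      kernConv φ (fun r => f (x₂ + r * I)) (w - x₂) := by
  wlog h12 : x₁ ≤ x₂ generalizing x₁ x₂
  · exact (this h₂ h₁ (le_of_not_ge h12)).symm
  have hk := differentiable_kern hφ.continuous hc
  obtain ⟨C, hC, hb⟩ := exists_norm_kern_le_strip hφ hc (|w.re| + x₂)
  have hM0 := nonneg_of_norm_le_on_rightHalfPlane hM
  have := integral_vertical_eq (H := fun z => f z * kern φ (w - z))
    (C := M * (C * (2 * (1 + w.im ^ 2)))) h12 ?_ ?_
  · simpa only [kernConv, sub_sub] using this
  · refine (hd.mono ?_).mul (hk.comp (differentiable_id.const_sub w)).differentiableOn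
    intro z hz
    exact h₁.trans_le hz.1
  · intro x hx y
    have hx0 : 0 < x := h₁.trans_le hx.1
    have h1 := hb (w - (x + y * I)) (by
      simp only [sub_re, add_re, ofReal_re, mul_re, I_re, mul_zero, ofReal_im, I_im, mul_one,
        sub_self, add_zero]
      refine (abs_sub _ _).trans ?_
      rw [abs_of_pos hx0]
      linarith [hx.2])
    simp only [sub_im, add_im, ofReal_im, mul_im, ofReal_re, I_im, mul_one, I_re, mul_zero,
      add_zero, zero_add] at h1
    -- Peetre's inequality `1 + y² ≤ 2 (1 + v²)(1 + (v - y)²)` with `v = im w`.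
    have h3 : C / (1 + (w.im - y) ^ 2) ≤ C * (2 * (1 + w.im ^ 2)) / (1 + y ^ 2) := by
      rw [div_le_div_iff₀ (by positivity) (by positivity), mul_assoc]
      refine mul_le_mul_of_nonneg_left ?_ hC
      nlinarith [sq_nonneg (w.im * (w.im - y)), sq_nonneg (w.im - y + w.im)]
    rw [norm_mul, mul_div_assoc]
    exact mul_le_mul (hM _ (add_mul_I_mem_rightHalfPlane hx0 y)) (h1.trans h3) (norm_nonneg _) hM0

/-- The convolution of (the boundary function of) `f` with a kernel. -/
def kernSmooth (φ : ℝ → ℂ) (f : ℂ → ℂ) (w : ℂ) : ℂ :=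
  kernConv φ (fun r => f ((1 : ℝ) + r * I)) (w - (1 : ℝ))

theorem vertical_aestronglyMeasurable {f : ℂ → ℂ} (hd : DifferentiableOn ℂ f rightHalfPlane)
    {x : ℝ} (hx : 0 < x) : AEStronglyMeasurable (fun r : ℝ => f (x + r * I)) volume :=
  (vertical_continuous hd.continuousOn (add_mul_I_mem_rightHalfPlane hx)).aestronglyMeasurable

theorem differentiable_kernSmooth {f : ℂ → ℂ} (hd : DifferentiableOn ℂ f rightHalfPlane) {M : ℝ}
    (hM : ∀ z ∈ rightHalfPlane, ‖f z‖ ≤ M) {φ : ℝ → ℂ} (hφ : ContDiff ℝ (⊤ : ℕ∞) φ)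
    (hc : HasCompactSupport φ) : Differentiable ℂ (kernSmooth φ f) :=
  (differentiable_kernConv hφ hc (vertical_aestronglyMeasurable hd one_pos)
    (Eventually.of_forall fun r => hM _ (add_mul_I_mem_rightHalfPlane one_pos r))).comp
    (differentiable_id.sub_const _)

/-- The line `re = 1` in `kernSmooth` is an arbitrary choice. Passing to the line `re = re w + a`
gives a kernel that does not depend on `w`; the free shift `a` is what the low frequency estimate
exploits. -/
theorem kernSmooth_eq {f : ℂ → ℂ} (hd : DifferentiableOn ℂ f rightHalfPlane) {M : ℝ}
    (hM : ∀ z ∈ rightHalfPlane, ‖f z‖ ≤ M) {φ : ℝ → ℂ} (hφ : ContDiff ℝ (⊤ : ℕ∞) φ)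
    (hc : HasCompactSupport φ) {w : ℂ} (hw : w ∈ rightHalfPlane) {a : ℝ} (ha : 0 ≤ a) :
    kernSmooth φ f w = ∫ s : ℝ, f (w + a + s * I) * kern φ (-(a + s * I)) := by
  have hx : 0 < w.re + a := add_pos_of_pos_of_nonneg hw ha
  rw [kernSmooth, kernConv_vertical_eq hd hM hφ hc w one_pos hx, kernConv,
    ← integral_add_right_eq_self _ w.im]
  congr 1; ext s
  have h1 : ((w.re + a : ℝ) + (s + w.im : ℝ) * I : ℂ) = w + a + s * I := by
    conv_rhs => rw [← re_add_im w]
    push_cast; ring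
  have h2 : (w - (w.re + a : ℝ) - (s + w.im : ℝ) * I : ℂ) = -(a + s * I) := by
    rw [sub_sub, h1]; ring
  rw [h1, h2]

theorem kernSmooth_sub {f : ℂ → ℂ} (hd : DifferentiableOn ℂ f rightHalfPlane) {M : ℝ}
    (hM : ∀ z ∈ rightHalfPlane, ‖f z‖ ≤ M) {φ ψ : ℝ → ℂ} (hφ : ContDiff ℝ (⊤ : ℕ∞) φ)
    (hc : HasCompactSupport φ) (hψ : ContDiff ℝ (⊤ : ℕ∞) ψ) (hcψ : HasCompactSupport ψ) (w : ℂ) :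
    kernSmooth (fun t => φ t - ψ t) f w = kernSmooth φ f w - kernSmooth ψ f w := by
  have hm := vertical_aestronglyMeasurable hd one_pos
  have hb : ∀ᵐ r : ℝ, ‖f ((1 : ℝ) + r * I)‖ ≤ M :=
    Eventually.of_forall fun r => hM _ (add_mul_I_mem_rightHalfPlane one_pos r)
  rw [kernSmooth, kernSmooth, kernSmooth, kernConv, kernConv, kernConv, ← integral_sub
    (integrable_kernConv hφ hc hm hb _) (integrable_kernConv hψ hcψ hm hb _)]
  congr 1; ext r
  rw [kern_sub hφ.continuous hc hψ.continuous hcψ, mul_sub]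

theorem kern_vertical_integrable {φ : ℝ → ℂ} (hφ : ContDiff ℝ (⊤ : ℕ∞) φ)
    (hc : HasCompactSupport φ) (z : ℂ) : Integrable fun s : ℝ => kern φ (z - s * I) := by
  simpa using integrable_kernConv hφ hc (g := fun _ => 1) (M := 1) (by fun_prop) (by simp) z

theorem norm_kernSmooth_le {f : ℂ → ℂ} (hd : DifferentiableOn ℂ f rightHalfPlane) {M : ℝ}
    (hM : ∀ z ∈ rightHalfPlane, ‖f z‖ ≤ M) {φ : ℝ → ℂ} (hφ : ContDiff ℝ (⊤ : ℕ∞) φ)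
    (hc : HasCompactSupport φ) {w : ℂ} (hw : w ∈ rightHalfPlane) :
    ‖kernSmooth φ f w‖ ≤ M * ∫ s : ℝ, ‖kern φ (0 - s * I)‖ := by
  rw [kernSmooth_eq hd hM hφ hc hw le_rfl, ← integral_const_mul]
  refine norm_integral_le_of_norm_le ((kern_vertical_integrable hφ hc 0).norm.const_mul M)
    (Eventually.of_forall fun s => ?_)
  rw [norm_mul]
  have : w + (0 : ℝ) + s * I ∈ rightHalfPlane := by simpa [rightHalfPlane] using hw
  have h := hM _ this
  simp only [ofReal_zero, zero_add, zero_sub] at h ⊢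
  gcongr

/-- Only `|t|` is restricted on the support of `φ`: negative frequencies are absent from `f`, as one
sees by pushing the line of integration to `+∞`. -/
theorem kernSmooth_mem_spectralSubspace {f : ℂ → ℂ} (hd : DifferentiableOn ℂ f rightHalfPlane)
    {M : ℝ} (hM : ∀ z ∈ rightHalfPlane, ‖f z‖ ≤ M) {φ : ℝ → ℂ} (hφ : ContDiff ℝ (⊤ : ℕ∞) φ)
    {ε δ : ℝ} (hε : 0 < ε) (hδ : 0 < δ) (hs : ∀ t, φ t ≠ 0 → ε ≤ |t| ∧ |t| ≤ δ) :
    kernSmooth φ f ∈ spectralSubspace (Set.Icc ε δ) := by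
  have hsupp : tsupport φ ⊆ Set.Icc (-δ) δ :=
    closure_minimal (fun t ht => abs_le.1 (hs t ht).2) isClosed_Icc
  have hc : HasCompactSupport φ := isCompact_Icc.of_isClosed_subset (isClosed_tsupport φ) hsupp
  have hM0 := nonneg_of_norm_le_on_rightHalfPlane hM
  have hG := differentiable_kernSmooth hd hM hφ hc
  have hm := vertical_aestronglyMeasurable hd one_pos
  have hb : ∀ᵐ r : ℝ, ‖f ((1 : ℝ) + r * I)‖ ≤ M :=
    Eventually.of_forall fun r => hM _ (add_mul_I_mem_rightHalfPlane one_pos r)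
  have hcont : Continuous fun s : ℝ => kernSmooth φ f (s * I) := hG.continuous.comp (by fun_prop)
  have hlim : ∀ s : ℝ, Tendsto (fun t : ℝ => kernSmooth φ f (t + s * I)) (𝓝[>] 0)
      (𝓝 (kernSmooth φ f (s * I))) := by
    intro s
    have : Continuous fun t : ℝ => kernSmooth φ f (t + s * I) := hG.continuous.comp (by fun_prop)
    simpa using (this.tendsto 0).mono_left nhdsWithin_le_nhds
  have hbd : ∀ s : ℝ, ‖kernSmooth φ f (s * I)‖ ≤ M * ∫ s : ℝ, ‖kern φ (0 - s * I)‖ := by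
    intro s
    refine le_of_tendsto (hlim s).norm ?_
    filter_upwards [self_mem_nhdsWithin] with t ht
    exact norm_kernSmooth_le hd hM hφ hc (add_mul_I_mem_rightHalfPlane ht s)
  have hmem : MemLp (fun s : ℝ => kernSmooth φ f (s * I)) ∞ volume :=
    memLp_top_of_bound hcont.aestronglyMeasurable _ (Eventually.of_forall hbd)
  refine ⟨⟨hG.differentiableOn, _, fun z hz => norm_kernSmooth_le hd hM hφ hc hz⟩,
    hmem.toLp _, ?_, ?_⟩
  · filter_upwards [hmem.coeFn_toLp] with s h
    rw [h]
    exact hlim s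
  · intro x hx
    refine (Distribution.mem_dsupport_iff x).1 hx _ (fun ψ hψ => ?_) isClosed_Icc
    -- `ψ` is supported off `[ε, δ]`, so only the negative half of the support of `φ` survives in
    -- the product.
    have hθs : tsupport (fun t => φ t * ψ t) ⊆ Set.Icc (-δ) (-ε) := by
      refine closure_minimal (fun t ht => ?_) isClosed_Icc
      have h1 := hs t (left_ne_zero_of_mul ht)
      have h2 : t ∉ Set.Icc ε δ := hψ (subset_tsupport ψ (right_ne_zero_of_mul ht))
      have h3 := abs_le.1 h1.2
      refine ⟨h3.1, ?_⟩
      by_contra h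
      have : ε ≤ t := by
        rcases le_abs.1 h1.1 with h4 | h4
        · exact h4
        · exact absurd (by linarith) h
      exact h2 ⟨this, h3.2⟩
    have hθ : ContDiff ℝ (⊤ : ℕ∞) fun t => φ t * ψ t := hφ.mul ψ.smooth'
    have hθc : HasCompactSupport fun t => φ t * ψ t := hc.mul_right
    have e1 : invFourier (Lp.toTemperedDistribution (hmem.toLp _)) ψ =
        kernConv (fun t => φ t * ψ t) (fun r => f ((1 : ℝ) + r * I)) (0 - (1 : ℝ)) := by
      rw [invFourier_toTemperedDistribution_apply,
        ← integral_kernConv_mul_invFourierSchwartz hφ hc hm hb ψ, kernConv]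
      refine integral_congr_ae ?_
      filter_upwards [hmem.coeFn_toLp] with s h
      rw [h, kernSmooth, invFourierSchwartz_eq_kern, zero_sub, zero_sub, neg_add_eq_sub]
    rw [e1]
    obtain ⟨C, hC, hk⟩ := exists_norm_kernConv_le hθ hM0 hθs
    have hz : Tendsto (fun x : ℝ => C * (Real.exp (-(δ * x)) + Real.exp (-(ε * x)))) atTop
        (𝓝 0) := by
      have h : ∀ a : ℝ, 0 < a → Tendsto (fun x : ℝ => Real.exp (-(a * x))) atTop (𝓝 0) :=
        fun a ha => Real.tendsto_exp_neg_atTop_nhds_zero.comp (tendsto_id.const_mul_atTop ha)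
      simpa using ((h δ hδ).add (h ε hε)).const_mul C
    -- The pairing is independent of the line `re = x`. There the kernel is evaluated at real part
    -- `-x`, where a symbol on `[-δ, -ε]` gives decay as `x → ∞`.
    refine norm_le_zero_iff.1 (ge_of_tendsto hz ?_)
    filter_upwards [eventually_gt_atTop 0] with x hx
    rw [kernConv_vertical_eq hd hM hθ hθc 0 one_pos hx]
    refine (hk _ (Eventually.of_forall fun r => hM _ (add_mul_I_mem_rightHalfPlane hx r)) _).trans
      (le_of_eq ?_)
    simp

/-! ### Estimates for functions in `𝓑₀` -/

/-- The supremum of `‖f'‖` over the vertical line through `x`. -/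
def derivSup (f : ℂ → ℂ) (x : ℝ) : ℝ≥0∞ := ⨆ y : ℝ, ‖deriv f (x + y * I)‖ₑ

theorem enorm_deriv_le_derivSup (f : ℂ → ℂ) (z : ℂ) : ‖deriv f z‖ₑ ≤ derivSup f z.re := by
  have := le_iSup (fun y : ℝ => ‖deriv f (z.re + y * I)‖ₑ) z.im
  simpa only [re_add_im, derivSup] using this

/-- Reduces the uncountable supremum in `derivSup` to a countable one, for measurability. -/
theorem iSup_real_eq_iSup_rat {h : ℝ → ℝ≥0∞} (hc : Continuous h) :
    ⨆ y : ℝ, h y = ⨆ q : ℚ, h q := by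
  refine le_antisymm (iSup_le fun y => ?_) (iSup_le fun q => le_iSup h (q : ℝ))
  have hcl : IsClosed {y : ℝ | h y ≤ ⨆ q : ℚ, h q} := isClosed_le hc continuous_const
  have : Set.range ((↑) : ℚ → ℝ) ⊆ {y : ℝ | h y ≤ ⨆ q : ℚ, h q} := by
    rintro _ ⟨q, rfl⟩
    exact le_iSup (fun q : ℚ => h q) q
  exact (Rat.denseRange_cast (𝕜 := ℝ)).closure_range ▸ closure_minimal this hcl <| Set.mem_univ y

theorem continuousOn_deriv {f : ℂ → ℂ} (hd : DifferentiableOn ℂ f rightHalfPlane) :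
    ContinuousOn (deriv f) rightHalfPlane :=
  (hd.deriv isOpen_rightHalfPlane).continuousOn

theorem aemeasurable_derivSup {f : ℂ → ℂ} (hd : DifferentiableOn ℂ f rightHalfPlane) :
    AEMeasurable (derivSup f) (volume.restrict (Set.Ioi 0)) := by
  refine ⟨fun x => ⨆ q : ℚ, ‖deriv f (x + (q : ℝ) * I)‖ₑ, ?_, ?_⟩
  · refine Measurable.iSup fun q => ?_
    exact ((measurable_deriv f).comp (by fun_prop)).enorm
  · filter_upwards [ae_restrict_mem measurableSet_Ioi] with x hx
    exact iSup_real_eq_iSup_rat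
      (vertical_continuous (continuousOn_deriv hd) (add_mul_I_mem_rightHalfPlane hx)).enorm

theorem enorm_sub_le_lintegral_derivSup {f : ℂ → ℂ} (hd : DifferentiableOn ℂ f rightHalfPlane)
    {z : ℂ} (hz : z ∈ rightHalfPlane) {a : ℝ} (ha : 0 ≤ a) :
    ‖f (z + a) - f z‖ₑ ≤ ∫⁻ x in Set.Ioc z.re (z.re + a), derivSup f x := by
  have hz' : 0 < z.re := hz
  have hmem : ∀ t ∈ Set.uIcc z.re (z.re + a), (t + z.im * I : ℂ) ∈ rightHalfPlane := by
    intro t ht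
    rw [Set.uIcc_of_le (by linarith)] at ht
    exact add_mul_I_mem_rightHalfPlane (hz'.trans_le ht.1) _
  have h := intervalIntegral.integral_eq_sub_of_hasDerivAt (a := z.re) (b := z.re + a)
    (f := fun t : ℝ => f (t + z.im * I)) (f' := fun t : ℝ => deriv f (t + z.im * I))
    (fun t ht => by
      have h1 := (hd.differentiableAt (isOpen_rightHalfPlane.mem_nhds (hmem t ht))).hasDerivAt
      have h2 : HasDerivAt (fun t : ℝ => (t + z.im * I : ℂ)) 1 t :=
        (hasDerivAt_id t).ofReal_comp.add_const _
      simpa [Function.comp_def] using h1.comp t h2)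
    (by
      refine ContinuousOn.intervalIntegrable ?_
      exact (continuousOn_deriv hd).comp (by fun_prop) hmem)
  have e1 : ((z.re + a : ℝ) + z.im * I : ℂ) = z + a := by
    conv_rhs => rw [← re_add_im z]
    push_cast; ring
  simp only [re_add_im] at h
  rw [e1] at h
  rw [← h, intervalIntegral.integral_of_le (by linarith)]
  refine (enorm_integral_le_lintegral_enorm _).trans (lintegral_mono fun t => ?_)
  exact le_iSup (fun y : ℝ => ‖deriv f (t + y * I)‖ₑ) z.im

/-- Integrate `f'` along the horizontal ray from `z`, where `f` tends to `0`. On `𝓑₀` the seminorm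
therefore controls the sup norm, with a bound by a tail. -/
theorem enorm_le_lintegral_derivSup {f : ℂ → ℂ} (hf : f ∈ besovZero) {z : ℂ}
    (hz : z ∈ rightHalfPlane) : ‖f z‖ₑ ≤ ∫⁻ x in Set.Ioi z.re, derivSup f x := by
  have hlim : Tendsto (fun a : ℝ => f (z + a)) atTop (𝓝 0) := by
    refine hf.2.comp (tendsto_comap_iff.2 ?_)
    simpa [Function.comp_def] using tendsto_atTop_add_const_left atTop z.re tendsto_id
  have h2 : Tendsto (fun a : ℝ => ‖f (z + a) - f z‖ₑ) atTop (𝓝 ‖f z‖ₑ) := by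
    simpa using (hlim.sub_const (f z)).enorm
  refine le_of_tendsto h2 ?_
  filter_upwards [eventually_ge_atTop 0] with a ha
  exact (enorm_sub_le_lintegral_derivSup hf.1.1 hz ha).trans
    (lintegral_mono_set Set.Ioc_subset_Ioi_self)

theorem besovZero_bounded {f : ℂ → ℂ} (hf : f ∈ besovZero) :
    ∃ M : ℝ, ∀ z ∈ rightHalfPlane, ‖f z‖ ≤ M := by
  have hfin : ∫⁻ x in Set.Ioi (0 : ℝ), derivSup f x < ∞ := hf.1.2
  refine ⟨(∫⁻ x in Set.Ioi (0 : ℝ), derivSup f x).toReal, fun z hz => ?_⟩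
  rw [← toReal_enorm]
  refine ENNReal.toReal_mono hfin.ne ((enorm_le_lintegral_derivSup hf hz).trans ?_)
  exact lintegral_mono_set (Set.Ioi_subset_Ioi (le_of_lt hz))

theorem tendsto_lintegral_derivSup_Ioi {f : ℂ → ℂ} (hf : f ∈ besovZero) :
    Tendsto (fun m : ℝ => ∫⁻ x in Set.Ioi m, derivSup f x) atTop (𝓝 0) := by
  have hfin : ∫⁻ x in Set.Ioi (0 : ℝ), derivSup f x ≠ ∞ := hf.1.2.ne
  have h : Tendsto (fun m : ℝ => ∫⁻ x in Set.Ioi 0, (Set.Ioi m).indicator (derivSup f) x) atTop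
      (𝓝 (∫⁻ _ in Set.Ioi (0 : ℝ), 0)) := by
    refine tendsto_of_seq_tendsto fun u hu => ?_
    refine tendsto_lintegral_of_dominated_convergence' (derivSup f)
      (fun n => (aemeasurable_derivSup hf.1.1).indicator measurableSet_Ioi)
      (fun n => Eventually.of_forall fun x => Set.indicator_le_self _ _ x) hfin
      (Eventually.of_forall fun x => ?_)
    refine tendsto_const_nhds.congr' ?_
    filter_upwards [hu.eventually_ge_atTop x] with n hn
    rw [Set.indicator_of_notMem (by simpa using hn)]
  rw [lintegral_zero] at h
  refine h.congr' ?_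
  filter_upwards [eventually_ge_atTop 0] with m hm
  rw [lintegral_indicator measurableSet_Ioi, Measure.restrict_restrict measurableSet_Ioi,
    Set.inter_eq_left.2 (Set.Ioi_subset_Ioi hm)]

theorem norm_deriv_le_of_bounded_right {h : ℂ → ℂ} {b r M : ℝ} (hr : 0 < r)
    (hd : DifferentiableOn ℂ h {z | b < z.re}) (hM : ∀ z : ℂ, b < z.re → ‖h z‖ ≤ M) {w : ℂ}
    (hw : b + r < w.re) : ‖deriv h w‖ ≤ M / r := by
  have hsub : Metric.closedBall w r ⊆ {z | b < z.re} := by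
    intro z hz
    have h2 := (abs_re_le_norm (z - w)).trans (mem_closedBall_iff_norm.1 hz)
    rw [sub_re] at h2
    have := (abs_le.1 h2).1
    rw [Set.mem_ofPred_eq]
    linarith
  refine norm_deriv_le_of_forall_mem_sphere_norm_le hr ?_ fun z hz =>
    hM z (hsub (Metric.sphere_subset_closedBall hz))
  exact (hd.mono hsub).diffContOnCl_ball le_rfl

/-- Cauchy estimates for the first two derivatives. -/
theorem norm_deriv_le_div {f : ℂ → ℂ} (hd : DifferentiableOn ℂ f rightHalfPlane) {M : ℝ}
    (hM : ∀ z ∈ rightHalfPlane, ‖f z‖ ≤ M) {x : ℝ} (hx : 0 < x) {w : ℂ} (hw : x < w.re) :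
    ‖deriv f w‖ ≤ M / x :=
  norm_deriv_le_of_bounded_right (b := 0) hx hd hM (by simpa using hw)

theorem norm_deriv_deriv_le_div {f : ℂ → ℂ} (hd : DifferentiableOn ℂ f rightHalfPlane) {M : ℝ}
    (hM : ∀ z ∈ rightHalfPlane, ‖f z‖ ≤ M) {x : ℝ} (hx : 0 < x) {w : ℂ} (hw : x < w.re) :
    ‖deriv (deriv f) w‖ ≤ M / (x / 2) / (x / 2) := by
  refine norm_deriv_le_of_bounded_right (b := x / 2) (half_pos hx) ?_
    (fun z hz => norm_deriv_le_div hd hM (half_pos hx) hz) (by linarith)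
  refine (hd.deriv isOpen_rightHalfPlane).mono fun z hz => ?_
  exact (half_pos hx).trans hz

theorem norm_sub_vertical_le {h : ℂ → ℂ} {b K : ℝ} (hd : DifferentiableOn ℂ h {z | b < z.re})
    (hK : ∀ z : ℂ, b < z.re → ‖deriv h z‖ ≤ K) {w : ℂ} (hw : b < w.re) (s : ℝ) :
    ‖h (w + s * I) - h w‖ ≤ K * |s| := by
  have hconv : Convex ℝ {z : ℂ | b < z.re} := convex_halfSpace_re_gt b
  have hopen : IsOpen {z : ℂ | b < z.re} := isOpen_lt continuous_const continuous_re
  have := hconv.norm_image_sub_le_of_norm_deriv_le (𝕜 := ℂ) (f := h)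
    (fun z hz => hd.differentiableAt (hopen.mem_nhds hz)) hK (x := w) (y := w + s * I) hw
    (by simpa using hw)
  simpa using this

/-- Quantitative uniform continuity in the vertical direction. -/
theorem exists_vertical_modulus {f : ℂ → ℂ} (hf : f ∈ besovZero) {η : ℝ} (hη : 0 < η) :
    ∃ L : ℝ, 0 ≤ L ∧ ∀ w ∈ rightHalfPlane, ∀ s : ℝ, ‖f (w + s * I) - f w‖ ≤ η + L * |s| := by
  obtain ⟨M, hM⟩ := besovZero_bounded hf
  have hM0 := nonneg_of_norm_le_on_rightHalfPlane hM
  have hfin : ∫⁻ x in Set.Ioi (0 : ℝ), derivSup f x ≠ ∞ := hf.1.2.ne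
  -- By absolute continuity of the integral, a short shift `a` to the right changes `f` by at most
  -- `η / 2`, uniformly up to the boundary. After the shift `f` is Lipschitz by Cauchy's estimate;
  -- the two shifts cost `η` in total.
  obtain ⟨δ, hδ, hsmall⟩ := exists_pos_setLIntegral_lt_of_measure_lt hfin
    (ε := ENNReal.ofReal (η / 2)) (by simpa using hη)
  obtain ⟨a, ha0, ha⟩ : ∃ a : ℝ, 0 < a ∧ ENNReal.ofReal a < δ := by
    obtain ⟨a, ha, ha'⟩ := ENNReal.lt_iff_exists_nnreal_btwn.1 hδ
    exact ⟨a, by exact_mod_cast ha, by simpa using ha'⟩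
  have hstep : ∀ z ∈ rightHalfPlane, ‖f (z + a) - f z‖ ≤ η / 2 := by
    intro z hz
    have hz' : 0 < z.re := hz
    have h1 := enorm_sub_le_lintegral_derivSup hf.1.1 hz ha0.le
    have h2 := hsmall (Set.Ioc z.re (z.re + a)) (lt_of_le_of_lt (Measure.restrict_le_self _)
      (by simpa using ha))
    rw [Measure.restrict_restrict measurableSet_Ioc, Set.inter_eq_left.2
      (Set.Ioc_subset_Ioi_self.trans (Set.Ioi_subset_Ioi hz'.le))] at h2
    have h3 := h1.trans h2.le
    rwa [← ofReal_norm, ENNReal.ofReal_le_ofReal_iff (by positivity)] at h3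
  refine ⟨M / (a / 2), by positivity, fun w hw s => ?_⟩
  have hw' : 0 < w.re := hw
  have hws : w + s * I ∈ rightHalfPlane := by simpa [rightHalfPlane] using hw
  have h1 := hstep w hw
  have h2 := hstep (w + s * I) hws
  have h3 := norm_sub_vertical_le (h := f) (b := a / 2) (K := M / (a / 2))
    (hf.1.1.mono fun z hz => (half_pos ha0).trans hz)
    (fun z hz => norm_deriv_le_div hf.1.1 hM (half_pos ha0) hz) (w := w + a)
    (by simp only [add_re, ofReal_re]; linarith) s
  have e : f (w + s * I) - f w = (f (w + a) - f w) - (f (w + s * I + a) - f (w + s * I)) +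
      (f (w + a + s * I) - f (w + a)) := by
    rw [add_right_comm w (a : ℂ)]; ring
  rw [e]
  refine (norm_add_le _ _).trans ((add_le_add (norm_sub_le _ _) h3).trans ?_)
  linarith

/-- Two Cauchy estimates of radius `re w / 4` bound `f''` on `re z > re w / 2`. The constant blows
up at the boundary, but it serves only for a limit at fixed `re w`. -/
theorem norm_deriv_sub_vertical_le {f : ℂ → ℂ} (hd : DifferentiableOn ℂ f rightHalfPlane) {M : ℝ}
    (hM : ∀ z ∈ rightHalfPlane, ‖f z‖ ≤ M) {w : ℂ} (hw : w ∈ rightHalfPlane) (s : ℝ) :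
    ‖deriv f (w + s * I) - deriv f w‖ ≤ M / (w.re / 2 / 2) / (w.re / 2 / 2) * |s| := by
  have hw' : 0 < w.re := hw
  exact norm_sub_vertical_le (b := w.re / 2)
    ((hd.deriv isOpen_rightHalfPlane).mono fun z hz => (half_pos hw').trans hz)
    (fun z hz => norm_deriv_deriv_le_div hd hM (half_pos hw') hz) (half_lt_self hw') s

/-- Differentiation of a vertical average. -/
theorem hasDerivAt_vertical_average {f : ℂ → ℂ} (hd : DifferentiableOn ℂ f rightHalfPlane) {M : ℝ}
    (hM : ∀ z ∈ rightHalfPlane, ‖f z‖ ≤ M) {κ : ℝ → ℂ} (hκ : Integrable κ) {a : ℝ} (ha : 0 ≤ a)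
    (b : ℝ) {w : ℂ} (hw : w ∈ rightHalfPlane) :
    HasDerivAt (fun w => ∫ s : ℝ, f (w + a + (b * s : ℝ) * I) * κ s)
      (∫ s : ℝ, deriv f (w + a + (b * s : ℝ) * I) * κ s) w := by
  have hw' : 0 < w.re := hw
  have hmem : ∀ z ∈ rightHalfPlane, ∀ s : ℝ, z + a + (b * s : ℝ) * I ∈ rightHalfPlane := by
    intro z hz s
    have hz' : 0 < z.re := hz
    simpa [rightHalfPlane] using add_pos_of_pos_of_nonneg hz' ha
  have hball : ∀ z ∈ Metric.ball w (w.re / 2), w.re / 2 < z.re := by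
    intro z hz
    have h2 := (abs_re_le_norm (z - w)).trans_lt (mem_ball_iff_norm.1 hz)
    rw [sub_re] at h2
    linarith [(abs_lt.1 h2).1]
  have hmeas : ∀ h : ℂ → ℂ, ContinuousOn h rightHalfPlane → ∀ z ∈ rightHalfPlane,
      AEStronglyMeasurable (fun s : ℝ => h (z + a + (b * s : ℝ) * I) * κ s) volume := by
    intro h hh z hz
    exact (hh.comp_continuous (by fun_prop) (hmem z hz)).aestronglyMeasurable.mul
      hκ.aestronglyMeasurable
  refine (hasDerivAt_integral_of_dominated_loc_of_deriv_le (𝕜 := ℂ) (μ := volume)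
    (F := fun (w : ℂ) (s : ℝ) => f (w + a + (b * s : ℝ) * I) * κ s)
    (F' := fun (w : ℂ) (s : ℝ) => deriv f (w + a + (b * s : ℝ) * I) * κ s) (x₀ := w)
    (s := Metric.ball w (w.re / 2)) (bound := fun s => M / (w.re / 2) * ‖κ s‖)
    (Metric.ball_mem_nhds _ (half_pos hw')) ?_ ?_ ?_ ?_ (hκ.norm.const_mul _) ?_).2
  · filter_upwards [isOpen_rightHalfPlane.mem_nhds hw] with z hz
    exact hmeas f hd.continuousOn z hz
  · refine (hκ.norm.const_mul M).mono' (hmeas f hd.continuousOn w hw)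
      (Eventually.of_forall fun s => ?_)
    rw [norm_mul]
    gcongr
    exact hM _ (hmem w hw s)
  · exact hmeas _ (continuousOn_deriv hd) w hw
  · refine Eventually.of_forall fun s z hz => ?_
    rw [norm_mul]
    gcongr
    refine norm_deriv_le_div hd hM (half_pos hw') ?_
    have := hball z hz
    simp
    linarith
  · refine Eventually.of_forall fun s z hz => ?_
    have hz' : z ∈ rightHalfPlane := (half_pos hw').trans (hball z hz)
    have h1 := (hd.differentiableAt (isOpen_rightHalfPlane.mem_nhds (hmem z hz' s))).hasDerivAt
    have h2 : HasDerivAt (fun z : ℂ => z + a + (b * s : ℝ) * I) 1 z :=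
      ((hasDerivAt_id z).add_const _).add_const _
    simpa using (h1.comp z h2).mul_const (κ s)

/-! ### Subadditivity of the norm and dilation of symbols -/

theorem supNorm_add_le (f g : ℂ → ℂ) : supNorm (f + g) ≤ supNorm f + supNorm g :=
  iSup₂_le fun z hz => (enorm_add_le _ _).trans
    (add_le_add (le_iSup₂ (f := fun z _ => ‖f z‖ₑ) z hz) (le_iSup₂ (f := fun z _ => ‖g z‖ₑ) z hz))

theorem besovSeminorm_add_le {f g : ℂ → ℂ} (hf : DifferentiableOn ℂ f rightHalfPlane)
    (hg : DifferentiableOn ℂ g rightHalfPlane) :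
    besovSeminorm (f + g) ≤ besovSeminorm f + besovSeminorm g := by
  have h := lintegral_add_left' (aemeasurable_derivSup hf) (derivSup g)
  refine le_trans ?_ h.le
  refine lintegral_mono_ae ?_
  filter_upwards [ae_restrict_mem measurableSet_Ioi] with x hx
  refine iSup_le fun y => ?_
  have hmem := isOpen_rightHalfPlane.mem_nhds (add_mul_I_mem_rightHalfPlane hx y)
  rw [deriv_add (hf.differentiableAt hmem) (hg.differentiableAt hmem)]
  exact (enorm_add_le _ _).trans (add_le_add (le_iSup (fun y : ℝ => ‖deriv f (x + y * I)‖ₑ) y)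
    (le_iSup (fun y : ℝ => ‖deriv g (x + y * I)‖ₑ) y))

theorem besovNorm_add_le {f g : ℂ → ℂ} (hf : DifferentiableOn ℂ f rightHalfPlane)
    (hg : DifferentiableOn ℂ g rightHalfPlane) :
    besovNorm (f + g) ≤ besovNorm f + besovNorm g := by
  refine (add_le_add (supNorm_add_le f g) (besovSeminorm_add_le hf hg)).trans (le_of_eq ?_)
  simp only [besovNorm]
  ring

theorem hasCompactSupport_comp_mul {φ : ℝ → ℂ} (hc : HasCompactSupport φ) {b : ℝ} (hb : 0 < b) :
    HasCompactSupport fun t => φ (b * t) :=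
  hc.comp_homeomorph (Homeomorph.mulLeft₀ b hb.ne')

/-- Dilating the symbol of `kernSmooth`, combined with a shift to the right. -/
theorem kernSmooth_comp_mul {f : ℂ → ℂ} (hd : DifferentiableOn ℂ f rightHalfPlane) {M : ℝ}
    (hM : ∀ z ∈ rightHalfPlane, ‖f z‖ ≤ M) {φ : ℝ → ℂ} (hφ : ContDiff ℝ (⊤ : ℕ∞) φ)
    (hc : HasCompactSupport φ) {w : ℂ} (hw : w ∈ rightHalfPlane) {a b : ℝ} (ha : 0 ≤ a)
    (hb : 0 < b) :
    kernSmooth (fun t => φ (b * t)) f w =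
      ∫ s : ℝ, f (w + a + (b * s : ℝ) * I) * kern φ (-(a / b : ℝ) - s * I) := by
  rw [kernSmooth_eq (φ := fun t => φ (b * t)) hd hM (hφ.comp (contDiff_const.mul contDiff_id))
    (hasCompactSupport_comp_mul hc hb) hw ha]
  have h := Measure.integral_comp_mul_left
    (fun s : ℝ => f (w + a + (b * s : ℝ) * I) * kern φ (-(a / b : ℝ) - s * I)) b⁻¹
  have hb' : (b : ℂ) ≠ 0 := by exact_mod_cast hb.ne'
  rw [inv_inv, abs_of_pos hb, real_smul, ← inv_mul_eq_iff_eq_mul₀ hb'] at h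
  rw [← h, ← integral_const_mul]
  congr 1; ext s
  rw [kern_comp_mul φ hb, mul_inv_cancel_left₀ hb.ne']
  have : -(a + s * I : ℂ) / b = -(a / b : ℝ) - (b⁻¹ * s : ℝ) * I := by
    push_cast; field_simp; ring
  rw [this]
  ring

/-! ### Low frequencies -/

/-- The low frequency part of a function in `𝓑₀` is small. -/
theorem tendsto_besovNorm_kernSmooth_low {f : ℂ → ℂ} (hf : f ∈ besovZero) {φ : ℝ → ℂ}
    (hφ : ContDiff ℝ (⊤ : ℕ∞) φ) (hc : HasCompactSupport φ) :
    Tendsto (fun m : ℝ => besovNorm (kernSmooth (fun t => φ (m * t)) f)) atTop (𝓝 0) := by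
  obtain ⟨M, hM⟩ := besovZero_bounded hf
  have hd := hf.1.1
  have hκ := kern_vertical_integrable hφ hc (-(1 : ℝ))
  -- Dilation and shift are both taken equal to `m`, so the kernel sits at real part `-m / m = -1`
  -- and its `L¹` norm `c` does not depend on `m`.
  set κ : ℝ → ℂ := fun s => kern φ (-(1 : ℝ) - s * I)
  set c : ℝ≥0∞ := ∫⁻ s, ‖κ s‖ₑ
  have hcfin : c ≠ ∞ := hκ.2.ne
  have hav : ∀ (h : ℂ → ℂ) (B : ℝ≥0∞) (w : ℂ) (m : ℝ), (∀ z : ℂ, z.re = w.re + m → ‖h z‖ₑ ≤ B) →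
      ‖∫ s : ℝ, h (w + m + (m * s : ℝ) * I) * κ s‖ₑ ≤ B * c := by
    intro h B w m hB
    refine (enorm_integral_le_lintegral_enorm _).trans ?_
    rw [← lintegral_const_mul'' _ hκ.aestronglyMeasurable.enorm]
    refine lintegral_mono fun s => ?_
    rw [enorm_mul]
    gcongr
    exact hB _ (by simp)
  have hrep : ∀ m : ℝ, 0 < m → Set.EqOn (kernSmooth (fun t => φ (m * t)) f)
      (fun w => ∫ s : ℝ, f (w + m + (m * s : ℝ) * I) * κ s) rightHalfPlane := by
    intro m hm w hw
    rw [kernSmooth_comp_mul hd hM hφ hc hw hm.le hm, div_self hm.ne']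
  have hT : Tendsto (fun m : ℝ => (∫⁻ x in Set.Ioi m, derivSup f x) * c +
      (∫⁻ x in Set.Ioi m, derivSup f x) * c) atTop (𝓝 0) := by
    have h1 : Tendsto (fun m : ℝ => (∫⁻ x in Set.Ioi m, derivSup f x) * c) atTop (𝓝 0) := by
      simpa using ENNReal.Tendsto.mul_const (tendsto_lintegral_derivSup_Ioi hf) (Or.inr hcfin)
    simpa using h1.add h1
  refine tendsto_of_tendsto_of_tendsto_of_le_of_le' tendsto_const_nhds hT
    (Eventually.of_forall fun _ => zero_le) ?_
  filter_upwards [eventually_gt_atTop 0] with m hm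
  refine add_le_add (iSup₂_le fun w hw => ?_) ?_
  · have hw' : 0 < w.re := hw
    rw [hrep m hm hw]
    refine hav f _ w m fun z hz => ?_
    refine (enorm_le_lintegral_derivSup hf (z := z) ?_).trans
      (lintegral_mono_set (Set.Ioi_subset_Ioi ?_))
    · show 0 < z.re
      rw [hz]; linarith
    · rw [hz]; linarith
  · have h1 : ∀ x ∈ Set.Ioi (0 : ℝ), ⨆ y : ℝ, ‖deriv (kernSmooth (fun t => φ (m * t)) f)
        (x + y * I)‖ₑ ≤ derivSup f (x + m) * c := by
      intro x hx
      refine iSup_le fun y => ?_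
      have hw := add_mul_I_mem_rightHalfPlane hx y
      rw [deriv_eq_of_eqOn (hrep m hm) hw,
        (hasDerivAt_vertical_average hd hM hκ hm.le m hw).deriv]
      refine hav (deriv f) _ _ m fun z hz => (enorm_deriv_le_derivSup f z).trans (le_of_eq ?_)
      rw [hz]; simp
    refine (setLIntegral_mono_ae' measurableSet_Ioi (Eventually.of_forall h1)).trans ?_
    rw [lintegral_mul_const' _ _ hcfin]
    refine mul_le_mul_left ?_ c
    -- Substituting `x + m` for `x` turns the integral over `x > 0` into the tail over `x > m`.
    rw [← lintegral_indicator measurableSet_Ioi, ← lintegral_indicator measurableSet_Ioi,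
      ← lintegral_add_right_eq_self ((Set.Ioi m).indicator (derivSup f)) m]
    refine le_of_eq (lintegral_congr fun x => ?_)
    by_cases hx : 0 < x
    · simp [Set.indicator, hx]
    · simp [Set.indicator, hx]

/-! ### High frequencies -/

/-- As `κ` has integral `1`, the difference is an average of `u 0 - u (b s)`. It is applied to `f`
with a small `A`, and to `f'` with `A = 0`. -/
theorem norm_sub_average_le {u κ : ℝ → ℂ} (hu : Continuous u) {A L b : ℝ}
    (h : ∀ s, ‖u s - u 0‖ ≤ A + L * |s|) (hκ : Integrable κ)
    (hκ1 : Integrable fun s => |s| * ‖κ s‖) (hone : ∫ s, κ s = 1) (hb : 0 ≤ b) :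
    ‖u 0 - ∫ s : ℝ, u (b * s) * κ s‖ ≤ A * (∫ s, ‖κ s‖) + L * (∫ s, |s| * ‖κ s‖) * b := by
  have hint : Integrable fun s => A * ‖κ s‖ + L * b * (|s| * ‖κ s‖) :=
    (hκ.norm.const_mul A).add (hκ1.const_mul (L * b))
  have hle : ∀ s, ‖(u (b * s) - u 0) * κ s‖ ≤ A * ‖κ s‖ + L * b * (|s| * ‖κ s‖) := by
    intro s
    rw [norm_mul]
    refine (mul_le_mul_of_nonneg_right (h (b * s)) (norm_nonneg _)).trans (le_of_eq ?_)
    rw [abs_mul, abs_of_nonneg hb]; ring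
  have hi : Integrable fun s => (u (b * s) - u 0) * κ s :=
    hint.mono' (((hu.comp (by fun_prop)).sub continuous_const).aestronglyMeasurable.mul
      hκ.aestronglyMeasurable) (Eventually.of_forall hle)
  have e : ∫ s : ℝ, u (b * s) * κ s = (∫ s : ℝ, (u (b * s) - u 0) * κ s) + u 0 := by
    have : u 0 = ∫ s, u 0 * κ s := by rw [integral_const_mul, hone, mul_one]
    conv_rhs => rw [this]
    rw [← integral_add (by simpa [← this] using hi) (hκ.const_mul _)]
    congr 1; ext s
    rw [← this]; ring
  rw [e, sub_add_cancel_right, norm_neg]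
  refine (norm_integral_le_of_norm_le hint (Eventually.of_forall hle)).trans (le_of_eq ?_)
  rw [integral_add (hκ.norm.const_mul A) (hκ1.const_mul (L * b)), integral_const_mul,
    integral_const_mul]
  ring

/-- The high frequency part of a function in `𝓑₀` is small. -/
theorem tendsto_besovNorm_sub_kernSmooth {f : ℂ → ℂ} (hf : f ∈ besovZero) {φ : ℝ → ℂ}
    (hφ : ContDiff ℝ (⊤ : ℕ∞) φ) (hc : HasCompactSupport φ) (hone : φ 0 = 1) {b : ℕ → ℝ}
    (hb : ∀ k, 0 < b k) (hb0 : Tendsto b atTop (𝓝 0)) :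
    Tendsto (fun k => besovNorm (f - kernSmooth (fun t => φ (b k * t)) f)) atTop (𝓝 0) := by
  obtain ⟨M, hM⟩ := besovZero_bounded hf
  have hd := hf.1.1
  have hfin : ∫⁻ x in Set.Ioi (0 : ℝ), derivSup f x ≠ ∞ := hf.1.2.ne
  set κ : ℝ → ℂ := fun s => kern φ (0 - s * I) with hκdef
  have hκ : Integrable κ := kern_vertical_integrable hφ hc 0
  have hκS : ∀ s, κ s = invFourierSchwartz (hc.toSchwartzMap hφ) s := by
    intro s
    simp only [invFourierSchwartz_eq_kern, hκdef, zero_sub]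
    rfl
  have hκ1 : Integrable fun s => |s| * ‖κ s‖ := by
    have := (invFourierSchwartz (hc.toSchwartzMap hφ)).integrable_pow_mul volume 1
    simpa [hκS] using this
  have hκint : ∫ s, κ s = 1 := by
    have := integral_invFourierSchwartz_mul_exp (hc.toSchwartzMap hφ) 0
    simp only [ofReal_zero, mul_zero, neg_zero, exp_zero, mul_one, ← hκS] at this
    rw [this]
    exact hone
  set c₀ := ∫ s, ‖κ s‖
  set c₁ := ∫ s, |s| * ‖κ s‖
  have hc₀ : 0 ≤ c₀ := integral_nonneg fun _ => norm_nonneg _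
  set c : ℝ≥0∞ := ∫⁻ s, ‖κ s‖ₑ
  have hcfin : c ≠ ∞ := hκ.2.ne
  have hrep : ∀ k, Set.EqOn (kernSmooth (fun t => φ (b k * t)) f)
      (fun w => ∫ s : ℝ, f (w + (0 : ℝ) + (b k * s : ℝ) * I) * κ s) rightHalfPlane := by
    intro k w hw
    rw [kernSmooth_comp_mul hd hM hφ hc hw le_rfl (hb k), zero_div, ofReal_zero, neg_zero]
  have hsm : ∀ k, Differentiable ℂ (kernSmooth (fun t => φ (b k * t)) f) := fun k =>
    differentiable_kernSmooth hd hM (hφ.comp (contDiff_const.mul contDiff_id))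
      (hasCompactSupport_comp_mul hc (hb k))
  have hmem : ∀ w ∈ rightHalfPlane, ∀ s : ℝ, w + s * I ∈ rightHalfPlane := by
    intro w hw s
    simpa [rightHalfPlane] using hw
  have hline : ∀ h : ℂ → ℂ, ContinuousOn h rightHalfPlane → ∀ w ∈ rightHalfPlane,
      Continuous fun s : ℝ => h (w + s * I) := fun h hh w hw =>
    hh.comp_continuous (by fun_prop) (hmem w hw)
  have hsup : Tendsto (fun k => supNorm (f - kernSmooth (fun t => φ (b k * t)) f)) atTop
      (𝓝 0) := by
    rw [ENNReal.tendsto_nhds_zero]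
    intro e he
    rcases eq_or_ne e ∞ with rfl | hetop
    · simp
    have he' : 0 < e.toReal := ENNReal.toReal_pos he.ne' hetop
    -- Half of `e` pays for the modulus term times `c₀`, the other half for the term of order `b k`;
    -- the `+ 1` avoids dividing by zero.
    have hη : 0 < e.toReal / 2 / (c₀ + 1) := by positivity
    obtain ⟨L, hL, hmod⟩ := exists_vertical_modulus hf hη
    have hlim : Tendsto (fun k => L * c₁ * b k) atTop (𝓝 0) := by simpa using hb0.const_mul (L * c₁)
    filter_upwards [hlim.eventually_le_const (half_pos he')] with k hk
    refine iSup₂_le fun w hw => ?_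
    rw [Pi.sub_apply, hrep k hw, ← ofReal_norm]
    refine ENNReal.ofReal_le_of_le_toReal ?_
    have h1 := norm_sub_average_le (u := fun s : ℝ => f (w + s * I)) (b := b k)
      (hline f hd.continuousOn w hw) (fun s => by simpa using hmod w hw s) hκ hκ1 hκint (hb k).le
    simp only [ofReal_zero, zero_mul, add_zero] at h1 ⊢
    refine h1.trans ?_
    have h2 : e.toReal / 2 / (c₀ + 1) * c₀ ≤ e.toReal / 2 := by
      rw [div_mul_eq_mul_div, div_le_iff₀ (by positivity)]
      nlinarith
    linarith
  have hderiv : ∀ k, ∀ w ∈ rightHalfPlane, deriv (f - kernSmooth (fun t => φ (b k * t)) f) w =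
      deriv f w - ∫ s : ℝ, deriv f (w + (b k * s : ℝ) * I) * κ s := by
    intro k w hw
    rw [deriv_sub (hd.differentiableAt (isOpen_rightHalfPlane.mem_nhds hw)) (hsm k w),
      deriv_eq_of_eqOn (hrep k) hw, (hasDerivAt_vertical_average hd hM hκ le_rfl (b k) hw).deriv]
    simp
  have hsem : Tendsto (fun k => besovSeminorm (f - kernSmooth (fun t => φ (b k * t)) f)) atTop
      (𝓝 0) := by
    -- The vertical average preserves the line `re = x`, so `(1 + c) derivSup f` is an integrable
    -- majorant. Pointwise convergence in `x` comes from the Lipschitz bound on `f'`.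
    have := tendsto_lintegral_of_dominated_convergence' (μ := volume.restrict (Set.Ioi (0 : ℝ)))
      (F := fun k => derivSup (f - kernSmooth (fun t => φ (b k * t)) f)) (f := fun _ => 0)
      (fun x => derivSup f x * (1 + c))
      (fun k => aemeasurable_derivSup (hd.sub (hsm k).differentiableOn))
      (fun k => ?_) ?_ ?_
    · rw [lintegral_zero] at this
      exact this
    · filter_upwards [ae_restrict_mem measurableSet_Ioi] with x hx
      refine iSup_le fun y => ?_
      have hw := add_mul_I_mem_rightHalfPlane hx y
      rw [hderiv k _ hw, mul_add, mul_one]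
      refine (enorm_sub_le).trans (add_le_add ?_ ?_)
      · simpa using enorm_deriv_le_derivSup f (x + y * I)
      · refine (enorm_integral_le_lintegral_enorm _).trans ?_
        rw [← lintegral_const_mul'' _ hκ.aestronglyMeasurable.enorm]
        refine lintegral_mono fun s => ?_
        rw [enorm_mul]
        gcongr
        simpa using enorm_deriv_le_derivSup f (x + y * I + (b k * s : ℝ) * I)
    · rw [lintegral_mul_const' _ _ (by simp [hcfin])]
      exact ENNReal.mul_ne_top hfin (by simp [hcfin])
    · filter_upwards [ae_restrict_mem measurableSet_Ioi] with x hx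
      have hlim : Tendsto (fun k => ENNReal.ofReal (M / (x / 2 / 2) / (x / 2 / 2) * c₁ * b k))
          atTop (𝓝 0) := by
        simpa using ENNReal.tendsto_ofReal (hb0.const_mul (M / (x / 2 / 2) / (x / 2 / 2) * c₁))
      refine tendsto_of_tendsto_of_tendsto_of_le_of_le tendsto_const_nhds hlim
        (fun _ => zero_le) fun k => ?_
      refine iSup_le fun y => ?_
      have hw := add_mul_I_mem_rightHalfPlane hx y
      rw [hderiv k _ hw, ← ofReal_norm]
      refine ENNReal.ofReal_le_ofReal ?_
      have h1 := norm_sub_average_le (u := fun s : ℝ => deriv f (x + y * I + s * I)) (b := b k)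
        (A := 0) (hline _ (continuousOn_deriv hd) _ hw)
        (fun s => by simpa using norm_deriv_sub_vertical_le hd hM hw s) hκ hκ1 hκint (hb k).le
      simpa using h1
  simpa [besovNorm] using hsup.add hsem

/-! ### Density -/

theorem exists_spectralUnion_besovNorm_sub_lt {f : ℂ → ℂ} (hf : f ∈ besovZero) {η : ℝ}
    (hη : 0 < η) : ∃ g ∈ spectralUnion, besovNorm (f - g) < ENNReal.ofReal η := by
  obtain ⟨M, hM⟩ := besovZero_bounded hf
  have hd := hf.1.1
  let χ : ContDiffBump (0 : ℝ) := ⟨1, 2, one_pos, one_lt_two⟩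
  obtain ⟨φ, hφχ⟩ : ∃ φ : ℝ → ℂ, φ = fun t => (χ t : ℂ) := ⟨_, rfl⟩
  have hφ : ContDiff ℝ (⊤ : ℕ∞) φ := hφχ ▸ ofRealCLM.contDiff.comp χ.contDiff
  have hc : HasCompactSupport φ :=
    hφχ ▸ χ.hasCompactSupport.comp_left (g := fun r : ℝ => (r : ℂ)) rfl
  have hφ1 : ∀ t, |t| ≤ 1 → φ t = 1 := by
    intro t ht
    rw [hφχ]
    simp [χ.one_of_mem_closedBall (x := t) (by simpa using ht)]
  have hφ0 : ∀ t, 2 ≤ |t| → φ t = 0 := by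
    intro t ht
    rw [hφχ]
    simp [χ.zero_of_le_dist (x := t) (by simpa using ht)]
  have hhalf : 0 < ENNReal.ofReal η / 2 := ENNReal.half_pos (by simpa using hη)
  have hhigh := tendsto_besovNorm_sub_kernSmooth hf hφ hc (hφ1 0 (by simp))
    (b := fun k : ℕ => 1 / ((k : ℝ) + 1)) (fun k => by positivity)
    tendsto_one_div_add_atTop_nhds_zero_nat
  obtain ⟨k, hk⟩ := (hhigh.eventually_lt_const hhalf).exists
  obtain ⟨m, hm, hm1⟩ := (((tendsto_besovNorm_kernSmooth_low hf hφ hc).eventually_lt_const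
    hhalf).and (eventually_ge_atTop 1)).exists
  obtain ⟨b, hbdef⟩ : ∃ b : ℝ, b = 1 / ((k : ℝ) + 1) := ⟨_, rfl⟩
  have hb : 0 < b := by rw [hbdef]; positivity
  have hb1 : b ≤ 1 := by
    rw [hbdef, div_le_one (by positivity)]
    linarith [(Nat.cast_nonneg k : (0 : ℝ) ≤ k)]
  simp only [← hbdef] at hk
  have hm0 : 0 < m := one_pos.trans_le hm1
  have hφb : ContDiff ℝ (⊤ : ℕ∞) fun t => φ (b * t) := hφ.comp (contDiff_const.mul contDiff_id)
  have hφm : ContDiff ℝ (⊤ : ℕ∞) fun t => φ (m * t) := hφ.comp (contDiff_const.mul contDiff_id)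
  have hcb := hasCompactSupport_comp_mul hc hb
  have hcm := hasCompactSupport_comp_mul hc hm0
  -- Since `b ≤ 1 ≤ m`, both terms of the symbol equal `1` for `|t| < 1 / m` and both vanish for
  -- `|t| > 2 / b`.
  refine ⟨kernSmooth (fun t => φ (b * t) - φ (m * t)) f, ⟨1 / m, 2 / b, by positivity, ?_,
    kernSmooth_mem_spectralSubspace hd hM (hφb.sub hφm) (by positivity) (by positivity)
      fun t ht => ?_⟩, ?_⟩
  · rw [div_lt_div_iff₀ hm0 hb]
    linarith
  · constructor
    · by_contra! hlt
      rw [lt_div_iff₀ hm0] at hlt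
      have h1 := hφ1 (m * t) (by rw [abs_mul, abs_of_pos hm0]; linarith)
      have h2 := hφ1 (b * t) (by
        rw [abs_mul, abs_of_pos hb]
        nlinarith [abs_nonneg t])
      exact ht (by rw [h1, h2, sub_self])
    · by_contra! hlt
      rw [div_lt_iff₀ hb] at hlt
      have h1 := hφ0 (b * t) (by rw [abs_mul, abs_of_pos hb]; linarith)
      have h2 := hφ0 (m * t) (by
        rw [abs_mul, abs_of_pos hm0]
        nlinarith [abs_nonneg t])
      exact ht (by rw [h1, h2, sub_self])
  · have e : f - kernSmooth (fun t => φ (b * t) - φ (m * t)) f =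
        (f - kernSmooth (fun t => φ (b * t)) f) + kernSmooth (fun t => φ (m * t)) f := by
      ext w
      simp only [Pi.sub_apply, Pi.add_apply, kernSmooth_sub hd hM hφb hcb hφm hcm]
      ring
    rw [e, ← ENNReal.add_halves (ENNReal.ofReal η)]
    refine (besovNorm_add_le ?_ ?_).trans_lt (ENNReal.add_lt_add hk hm)
    · exact hd.sub (differentiable_kernSmooth hd hM hφb hcb).differentiableOn
    · exact (differentiable_kernSmooth hd hM hφm hcm).differentiableOn

end

end BesovHalfPlane


theorem proposition2p11 :
    BesovHalfPlane.spectralUnion ⊆ BesovHalfPlane.besovZero ∧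
      ∀ f ∈ BesovHalfPlane.besovZero, ∀ η : ℝ, 0 < η →
        ∃ g ∈ BesovHalfPlane.spectralUnion,
          BesovHalfPlane.besovNorm (f - g) < ENNReal.ofReal η := by
  exact ⟨BesovHalfPlane.spectralUnion_subset_besovZero, fun _ hf _ hη =>
    BesovHalfPlane.exists_spectralUnion_besovNorm_sub_lt hf hη⟩
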